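/- **Setting.** A weighted stochastic graph consists of a finite simple graph $G=(V,E)$, edge weights $w_e\ge 0$ and probabilities $p_e\in(0,1]$; its realization $\mathcal G$ contains each edge $e\in E$ independently with probability $p_e$. Put $p=\min_{e\in E}p_e$ and $w(M)=\sum_{e\in M}w_e$, and let $\mu$ be any deterministic rule that returns a maximum-weight matching $\mu(S)$ of every subgraph $S$ of $G$. **Variance-bounding algorithms.** Let $\alpha\in(0.5,1)$. An *$\alpha$-approximation variance-bounding matching algorithm* takes as input (1) a weighted stochastic graph $H=(V,E_H)$ with realization $\mathcal H$, and (2) a matching $M_{\mathcal O}$ of $\mathcal H$ found by an arbitrary, possibly randomized algorithm (that is, drawn from a distribution on the matchings of $\mathcal H$ that depends on $\mathcal H$; the algorithm may use these distributions). It outputs, possibly using fresh randomness, a matching $M_c$ of $\mathcal H$ and a set $A$ of vertices unmatched in $M_c$, such that for some constant $\delta\in(0,1)$, the same for all inputs, the following hold, where probabilities are over $\mathcal H$, $M_{\mathcal O}$ and the algorithm: 1. $\mathbb E[w(M_c)]\ge\alpha\,\mathbb E[w(M_{\mathcal O})]$. 2. $\Pr[v\in A]\ge\Pr[v\text{ is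 not matched by }M_{\mathcal O}]$ for every $v\in V$. 3. $\Pr[\{u,v\}\subseteq A]\ge\delta$ for all distinct $u,v\in V$ that are not adjacent in $H$. 4. For every $\tau\in(0,1)$, every fractional matching $x$ of the complement $\overline H=(V,\overline E)$ of $H$ with $x_e\le\tau$ for all $e\in\overline E$, and every $v\in V$, the random variable $$Z_v=\sum_{(u,v)\in\overline E}\frac{x_{(u,v)}}{\Pr[\{u,v\}\subseteq A]}\,\mathbf 1_{u\in A}\qquad\text{satisfies}\qquad \mathrm{Var}(Z_v)\le\frac{6\tau}{\delta^2}.$$ (A fractional matching $x$ has $x_e\in[0,1]$ for each edge and $\sum_{e\ni v}x_e\le1$ for each vertex $v$.) **Lemma (The Reduction).** Let $\alpha\in(0.5,1)$ and $\varepsilon\in(0,0.1)$, and suppose that an $\alpha$-approximation variance-bounding matching algorithm exists. Then the weighted stochastic matching problem has a $\left(\frac1{2-\alpha}-\varepsilon\right)$-approximation algorithm with $O_\varepsilon(1/p)$ queries per vertex. Precisely, there is a constant $K>0$, which depends on no weighted stochastic graph, such that for every weighted stochastic graph $G$ and every rule $\mu$ as above the following holds. Let $t=\lfloor K/p\rfloor$,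 draw $t$ independent realizations $G_1,\dots,G_t$ of $G$, independently of $\mathcal G$, and let $Q=\mu(G_1)\cup\dots\cup\mu(G_t)$ (with $Q=\emptyset$ if $G$ has no edges). Then $Q$ is always a subgraph of $G$ of maximum degree at most $K/p$, and $$\mathbb E\big[w(\mu(Q\cap\mathcal G))\big]\;\ge\;\Big(\frac1{2-\alpha}-\varepsilon\Big)\,\mathbb E\big[w(\mu(\mathcal G))\big].$$ -/

import Mathlib

universe u

/-- Expectation of a real function under a distribution on a finite type. -/
noncomputable def PMF.expect {Ω : Type*} [Fintype Ω] (d : PMF Ω) (f : Ω → ℝ) : ℝ :=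
  ∑ ω, (d ω).toReal * f ω

open Classical in
/-- Probability of an event under a distribution on a finite type. -/
noncomputable def PMF.prob {Ω : Type*} [Fintype Ω] (d : PMF Ω) (P : Ω → Prop) : ℝ :=
  d.expect fun ω => if P ω then 1 else 0

/-- Variance of a real function under a distribution on a finite type. -/
noncomputable def PMF.variance {Ω : Type*} [Fintype Ω] (d : PMF Ω) (f : Ω → ℝ) : ℝ :=
  d.expect fun ω => (f ω - d.expect f) ^ 2

/-- `M` is a matching contained in the edge set `S`: no two distinct edges share a vertex. -/
def IsMatchingIn {V : Type*} (S M : Finset (Sym2 V)) : Prop :=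
  M ⊆ S ∧ ∀ e ∈ M, ∀ f ∈ M, ∀ v, v ∈ e → v ∈ f → e = f

/-- The vertex `v` is matched by `M`. -/
def IsMatchedBy {V : Type*} (M : Finset (Sym2 V)) (v : V) : Prop :=
  ∃ e ∈ M, v ∈ e

open Classical in
/-- The degree of `v` in the subgraph with edge set `Q`. -/
noncomputable def edgeDegree {V : Type*} (Q : Finset (Sym2 V)) (v : V) : ℕ :=
  (Q.filter fun e => v ∈ e).card

open Classical in
/-- `x` is a fractional matching of the graph `G` (values outside the edge set are irrelevant). -/
def IsFractionalMatching {V : Type*} [Fintype V] (G : SimpleGraph V) (x : Sym2 V → ℝ) : Prop :=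
  (∀ e ∈ G.edgeSet, 0 ≤ x e ∧ x e ≤ 1) ∧
    ∀ v, ∑ u ∈ Finset.univ.filter (fun u => G.Adj u v), x s(u, v) ≤ 1

/-- A weighted stochastic graph: a simple graph with nonnegative edge weights, whose edges `e`
are realized independently, each with probability `p e ∈ (0, 1]`. -/
structure StochGraph (V : Type u) where
  G : SimpleGraph V
  w : Sym2 V → ℝ
  p : Sym2 V → ℝ
  w_nonneg : ∀ e ∈ G.edgeSet, 0 ≤ w e
  p_pos : ∀ e ∈ G.edgeSet, 0 < p e
  p_le_one : ∀ e ∈ G.edgeSet, p e ≤ 1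

namespace StochGraph

variable {V : Type u} [Fintype V]

open Classical in
/-- The edge set of the base graph. -/
noncomputable def edges (I : StochGraph V) : Finset (Sym2 V) :=
  Finset.univ.filter fun e => e ∈ I.G.edgeSet

theorem mem_edges (I : StochGraph V) (e : Sym2 V) : e ∈ I.edges ↔ e ∈ I.G.edgeSet := by
  simp [edges]

variable [DecidableEq V]

/-- The weight of a set of edges. -/
def weight (I : StochGraph V) (M : Finset (Sym2 V)) : ℝ := ∑ e ∈ M, I.w e

/-- The smallest realization probability `min_{e ∈ E} p e` (it is `0` if there are no edges). -/
noncomputable def pmin (I : StochGraph V) : ℝ := ⨅ e : I.G.edgeSet, I.p e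

/-- The probability that the set of realized edges is exactly `S`. -/
noncomputable def mass (I : StochGraph V) (S : Finset (Sym2 V)) : ℝ :=
  if S ⊆ I.edges then (∏ e ∈ S, I.p e) * ∏ e ∈ I.edges \ S, (1 - I.p e) else 0

theorem mass_nonneg (I : StochGraph V) (S : Finset (Sym2 V)) : 0 ≤ I.mass S := by
  unfold mass
  split_ifs with h
  · refine mul_nonneg (Finset.prod_nonneg fun e he => ?_) (Finset.prod_nonneg fun e he => ?_)
    · exact (I.p_pos e ((I.mem_edges e).1 (h he))).le
    · exact sub_nonneg.2 (I.p_le_one e ((I.mem_edges e).1 (Finset.mem_sdiff.1 he).1))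
  · exact le_rfl

theorem sum_mass (I : StochGraph V) : ∑ S, I.mass S = 1 := by
  have h := Finset.prod_add I.p (fun e => 1 - I.p e) I.edges
  simp only [add_sub_cancel, Finset.prod_const_one] at h
  rw [h]
  unfold mass
  rw [← Finset.sum_filter]
  refine Finset.sum_congr ?_ fun _ _ => rfl
  ext S
  simp

/-- The distribution of the realized edge set: each edge `e` is included independently with
probability `p e`. -/
noncomputable def realization (I : StochGraph V) : PMF (Finset (Sym2 V)) :=
  PMF.ofFintype (fun S => ENNReal.ofReal (I.mass S)) (by
    rw [← ENNReal.ofReal_sum_of_nonneg fun S _ => I.mass_nonneg S, I.sum_mass,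
      ENNReal.ofReal_one])

/-- `μ` is a deterministic rule that returns a maximum-weight matching of every subgraph. -/
def IsMaxMatchingRule (I : StochGraph V) (μ : Finset (Sym2 V) → Finset (Sym2 V)) : Prop :=
  ∀ S ⊆ I.edges, IsMatchingIn S (μ S) ∧ ∀ M, IsMatchingIn S M → I.weight M ≤ I.weight (μ S)

/-- The randomized algorithm that selects the edges to be queried: it draws `t` independent
realizations of the base graph and outputs the union of their maximum-weight matchings. -/
noncomputable def selectQueries (I : StochGraph V) (μ : Finset (Sym2 V) → Finset (Sym2 V)) :
    ℕ → PMF (Finset (Sym2 V))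
  | 0 => PMF.pure ∅
  | t + 1 => (selectQueries I μ t).bind fun Q => I.realization.map fun S => Q ∪ μ S

/-- The expected weight of a maximum-weight matching of the whole realized graph. -/
noncomputable def expectedOpt (I : StochGraph V) (μ : Finset (Sym2 V) → Finset (Sym2 V)) : ℝ :=
  I.realization.expect fun S => I.weight (μ S)

/-- The expected weight of a maximum-weight matching among the realized edges of `Q`, where `Q` is
drawn from the distribution `d` independently of the realization. -/
noncomputable def expectedValue (I : StochGraph V) (μ : Finset (Sym2 V) → Finset (Sym2 V))
    (d : PMF (Finset (Sym2 V))) : ℝ :=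
  d.expect fun Q => I.realization.expect fun S => I.weight (μ (Q ∩ S))

/-- A (potentially randomized) algorithm that finds a matching in every realized subgraph: for each
possible set `S` of realized edges, the distribution of a matching of `S`. -/
structure MatchingRule (I : StochGraph V) where
  law : Finset (Sym2 V) → PMF (Finset (Sym2 V))
  isMatching : ∀ S ⊆ I.edges, ∀ M ∈ (law S).support, IsMatchingIn S M

end StochGraph

/-- The type of the algorithms that may be variance-bounding. Such an algorithm is given a weighted
stochastic graph `H`, the randomized rule that produces the matching `M_O`, the realized edges of
`H` and the matching `M_O` found in them; it outputs, possibly using fresh randomness, a set `M_c`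
of edges and a set `A` of vertices. -/
def MatchingAlgorithm : Type (u + 1) :=
  ∀ (V : Type u) [Fintype V] [DecidableEq V] (H : StochGraph V) (_ : H.MatchingRule),
    Finset (Sym2 V) → Finset (Sym2 V) → PMF (Finset (Sym2 V) × Finset V)

namespace MatchingAlgorithm

variable {V : Type u} [Fintype V] [DecidableEq V]

/-- The joint distribution of the realized edge set of `H`, the matching `M_O`, and the output
`M_c`, `A` of the algorithm. -/
noncomputable def run (alg : MatchingAlgorithm.{u}) (H : StochGraph V) (σ : H.MatchingRule) :
    PMF (Finset (Sym2 V) × Finset (Sym2 V) × Finset (Sym2 V) × Finset V) :=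
  H.realization.bind fun S => (σ.law S).bind fun M =>
    (alg V H σ S M).map fun out => (S, M, out.1, out.2)

/-- The probability that both `u` and `v` are in `A`. -/
noncomputable def probBoth (alg : MatchingAlgorithm.{u}) (H : StochGraph V) (σ : H.MatchingRule)
    (u v : V) : ℝ :=
  (alg.run H σ).prob fun ω => u ∈ ω.2.2.2 ∧ v ∈ ω.2.2.2

open Classical in
/-- The value `Z_v = ∑ x_{uv} / Pr[{u, v} ⊆ A]`, the sum being over all `u ∈ A` that are adjacent to
`v` in the complement of `H`. -/
noncomputable def Z (alg : MatchingAlgorithm.{u}) (H : StochGraph V) (σ : H.MatchingRule)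
    (x : Sym2 V → ℝ) (v : V) (A : Finset V) : ℝ :=
  ∑ u ∈ Finset.univ.filter (fun u => H.Gᶜ.Adj u v),
    x s(u, v) / alg.probBoth H σ u v * (if u ∈ A then 1 else 0)

/-- `alg` is an `α`-approximation variance-bounding matching algorithm with constant `δ`. -/
structure IsVarianceBounding (alg : MatchingAlgorithm.{u}) (α δ : ℝ) : Prop where
  /-- `M_c` is a matching of the realization of `H`. -/
  isMatching : ∀ (V : Type u) [Fintype V] [DecidableEq V] (H : StochGraph V) (σ : H.MatchingRule),
    ∀ ω ∈ (alg.run H σ).support, IsMatchingIn ω.1 ω.2.2.1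
  /-- The vertices of `A` are unmatched in `M_c`. -/
  unmatched : ∀ (V : Type u) [Fintype V] [DecidableEq V] (H : StochGraph V) (σ : H.MatchingRule),
    ∀ ω ∈ (alg.run H σ).support, ∀ v ∈ ω.2.2.2, ¬ IsMatchedBy ω.2.2.1 v
  /-- In expectation, `M_c` is an `α`-approximation of `M_O`. -/
  approx : ∀ (V : Type u) [Fintype V] [DecidableEq V] (H : StochGraph V) (σ : H.MatchingRule),
    α * (alg.run H σ).expect (fun ω => H.weight ω.2.1) ≤
      (alg.run H σ).expect (fun ω => H.weight ω.2.2.1)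
  /-- `Pr[v ∈ A] ≥ Pr[v ∉ M_O]`. -/
  alive : ∀ (V : Type u) [Fintype V] [DecidableEq V] (H : StochGraph V) (σ : H.MatchingRule)
    (v : V), (alg.run H σ).prob (fun ω => ¬ IsMatchedBy ω.2.1 v) ≤
      (alg.run H σ).prob (fun ω => v ∈ ω.2.2.2)
  /-- Two distinct vertices that are not adjacent in `H` are both in `A` with probability at
  least `δ`. -/
  both_alive : ∀ (V : Type u) [Fintype V] [DecidableEq V] (H : StochGraph V) (σ : H.MatchingRule)
    (u v : V), u ≠ v → ¬ H.G.Adj u v → δ ≤ alg.probBoth H σ u v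
  /-- The variance bound for `Z_v`. -/
  variance_le : ∀ (V : Type u) [Fintype V] [DecidableEq V] (H : StochGraph V) (σ : H.MatchingRule)
    (τ : ℝ), 0 < τ → τ < 1 → ∀ x : Sym2 V → ℝ, IsFractionalMatching H.Gᶜ x →
      (∀ e ∈ H.Gᶜ.edgeSet, x e ≤ τ) →
      ∀ v, (alg.run H σ).variance (fun ω => alg.Z H σ x v ω.2.2.2) ≤ 6 * τ / δ ^ 2

end MatchingAlgorithm

/-! Let q_e be the probability that e lies in the optimal matching of a realization, so that the
optimum is Σ q_e w_e. An edge is crucial if q_e ≥ τp (`crucial`). Write C and N for the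
contributions of the crucial and the noncrucial edges to the optimum, and W for the expected weight
obtained from the queries. Up to factors close to 1, two bounds hold: W ≥ C
(`le_expect_weight_crucial`) and W ≥ αC + N (`le_expect_weight_augmented`). Adding 1 − α times the
former to the latter gives (2 − α)W ≥ C + N.

The bound W ≥ C holds because a crucial edge is almost surely among the samples once tp is large
compared with 1/τ; so the crucial part of the optimal matching mostly survives in Q.

For the other bound, run the variance-bounding algorithm on the crucial subgraph H. Its M_O is the
crucial part of the optimal matching when the noncrucial edges are drawn afresh, which has the law
of μ(𝒢) restricted to crucial edges. The resulting M_c is worth αC, and it remains to match the free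
vertices A along noncrucial edges at a value near N. A realized noncrucial edge with both ends in A,
seen in a fraction f_e of the samples, gets the raw value f_e / (p_e Pr[e ⊆ A]), whose mean is
exactly q_e (`expect_rawValue`).

These values may overload a vertex v. Let the load of v ignore whether v itself is free. Averaged
over samples and noncrucial realization it is Z_v, which concentrates by hypothesis, while E[1_{v ∈
A} Z_v] is the sum of the noncrucial q_e at v, at most Pr[v ∈ A]. Concentration then forces E Z_v ≤
1 + small (`excess_mean_le`). The remaining randomness adds little, since q_e is small compared with
p and tp is large (`expect_excess_le`). Damping each value by the excess loads of its endpoints and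
by its own size yields a fractional matching with entries at most η. A size-biasing argument shows
that almost nothing is lost in the mean (`le_expect_edgeValue`).

Graphs need not be bipartite, but small entries make odd sets harmless: scaled up, the fractional
matching is a multigraph of small multiplicity, edge-colourable by Kempe exchanges with few extra
colours, and some colour class is a good matching (`exists_matching_of_fractional`). -/

/-! ### Edge colouring with demands, and rounding of fractional matchings with small entries -/

open Finset in
/-- In a graph of maximum degree at most two, no component contains three vertices of degree at
most one. -/
theorem not_reachable_of_degree_le {V : Type*} [Fintype V] (F : SimpleGraph V)
    [DecidableRel F.Adj] (h2 : ∀ v, F.degree v ≤ 2) {x y z : V} (hxy : x ≠ y) (hxz : x ≠ z)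
    (hyz : y ≠ z) (hx : F.degree x ≤ 1) (hy : F.degree y ≤ 1) (hz : F.degree z ≤ 1)
    (rxy : F.Reachable y x) (rxz : F.Reachable z x) : False := by
  classical
  set c := F.connectedComponentMk x with hc
  have memx : x ∈ c.supp := rfl
  have memy : y ∈ c.supp := SimpleGraph.ConnectedComponent.sound rxy
  have memz : z ∈ c.supp := SimpleGraph.ConnectedComponent.sound rxz
  have hcon : (F.induce c.supp).Connected := c.connected_toSimpleGraph
  -- A component on n vertices has at least n − 1 edges, hence degree sum at least 2n − 2; the three
  -- given vertices would push the degree sum down to 2n − 3.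
  have hcard := hcon.card_vert_le_card_edgeSet_add_one
  have hsum := (F.induce c.supp).sum_degrees_eq_twice_card_edges
  have hdeg : ∀ v : c.supp, (F.induce c.supp).degree v ≤ F.degree v := by
    intro v
    rw [← SimpleGraph.card_neighborFinset_eq_degree, ← SimpleGraph.card_neighborFinset_eq_degree]
    refine card_le_card_of_injOn Subtype.val ?_ Subtype.val_injective.injOn
    intro u hu
    simp only [SimpleGraph.mem_neighborFinset, mem_coe] at hu ⊢
    exact hu
  let T : Finset c.supp := {⟨x, memx⟩, ⟨y, memy⟩, ⟨z, memz⟩}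
  have hT : T.card = 3 := by
    rw [card_eq_three]
    exact ⟨_, _, _, by simpa using hxy, by simpa using hxz, by simpa using hyz, rfl⟩
  have hle : ∑ v, (F.induce c.supp).degree v + ∑ v, (if v ∈ T then 1 else 0) ≤
      ∑ _v : c.supp, 2 := by
    rw [← sum_add_distrib]
    refine sum_le_sum fun v _ => ?_
    have h1 := hdeg v
    split_ifs with hv
    · simp only [T, mem_insert, mem_singleton] at hv
      rcases hv with rfl | rfl | rfl
      · have := h1.trans hx; omega
      · have := h1.trans hy; omega
      · have := h1.trans hz; omega
    · exact h1.trans (h2 v)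
  rw [sum_boole, filter_mem_eq_inter, univ_inter, hT, hsum] at hle
  rw [sum_const, card_univ] at hle
  rw [Nat.card_eq_fintype_card, Nat.card_eq_fintype_card, ← SimpleGraph.edgeFinset_card] at hcard
  simp only [smul_eq_mul, Nat.cast_id] at hle
  omega

theorem IsMatchingIn.mono {V : Type*} {S M M' : Finset (Sym2 V)} (h : IsMatchingIn S M) (hM : M' ⊆ M) :
    IsMatchingIn S M' :=
  ⟨hM.trans h.1, fun e he f hf => h.2 e (hM he) f (hM hf)⟩

section Kempe

variable {V : Type*} [DecidableEq V]

theorem IsMatchingIn.insert {S M : Finset (Sym2 V)} (h : IsMatchingIn S M) {x y : V}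
    (hS : s(x, y) ∈ S) (hx : ¬ IsMatchedBy M x) (hy : ¬ IsMatchedBy M y) :
    IsMatchingIn S (insert s(x, y) M) := by
  refine ⟨Finset.insert_subset hS h.1, ?_⟩
  have key : ∀ f ∈ M, ∀ v, v ∈ s(x, y) → v ∈ f → False := by
    intro f hf v hv hvf
    rcases Sym2.mem_iff.1 hv with rfl | rfl
    · exact hx ⟨f, hf, hvf⟩
    · exact hy ⟨f, hf, hvf⟩
  intro e he f hf v hve hvf
  rcases Finset.mem_insert.1 he with rfl | he <;> rcases Finset.mem_insert.1 hf with rfl | hf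
  · rfl
  · exact (key f hf v hve hvf).elim
  · exact (key e he v hvf hve).elim
  · exact h.2 e he f hf v hve hvf

/-- Exchanging two matchings on a union of components of their union. -/
theorem exists_swap_of_closed {S A B : Finset (Sym2 V)} (hA : IsMatchingIn S A)
    (hB : IsMatchingIn S B) (P : V → Prop)
    (hP : ∀ e ∈ A ∪ B, ∀ u ∈ e, ∀ v ∈ e, P u → P v) :
    ∃ A' B', IsMatchingIn S A' ∧ IsMatchingIn S B' ∧
      (∀ e, (if e ∈ A' then 1 else 0) + (if e ∈ B' then 1 else 0) =
        (if e ∈ A then 1 else 0) + (if e ∈ B then 1 else 0 : ℕ)) ∧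
      (∀ v, ¬ P v → ¬ IsMatchedBy B v → ¬ IsMatchedBy B' v) ∧
      (∀ v, P v → ¬ IsMatchedBy A v → ¬ IsMatchedBy B' v) := by
  classical
  have swap : ∀ A B : Finset (Sym2 V), IsMatchingIn S A → IsMatchingIn S B →
      (∀ e ∈ A ∪ B, ∀ u ∈ e, ∀ v ∈ e, P u → P v) →
      IsMatchingIn S ({e ∈ A | ∀ v ∈ e, ¬ P v} ∪ {e ∈ B | ∃ v ∈ e, P v}) := by
    intro A B hA hB hP
    refine ⟨Finset.union_subset ((Finset.filter_subset _ _).trans hA.1)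
      ((Finset.filter_subset _ _).trans hB.1), ?_⟩
    intro e he f hf v hve hvf
    simp only [Finset.mem_union, Finset.mem_filter] at he hf
    rcases he with he | he <;> rcases hf with hf | hf
    · exact hA.2 e he.1 f hf.1 v hve hvf
    · obtain ⟨u, hu, hPu⟩ := hf.2
      exact (he.2 v hve (hP f (Finset.mem_union_right _ hf.1) u hu v hvf hPu)).elim
    · obtain ⟨u, hu, hPu⟩ := he.2
      exact (hf.2 v hvf (hP e (Finset.mem_union_right _ he.1) u hu v hve hPu)).elim
    · exact hB.2 e he.1 f hf.1 v hve hvf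
  refine ⟨_, _, swap A B hA hB hP, swap B A hB hA (by rwa [Finset.union_comm]), ?_, ?_, ?_⟩
  · intro e
    by_cases h : ∃ v ∈ e, P v
    · have h' : ¬ ∀ v ∈ e, ¬ P v := by push Not; exact h
      simp only [Finset.mem_union, Finset.mem_filter, h, h', and_true, and_false, false_or]
      rw [add_comm]
    · have h' : ∀ v ∈ e, ¬ P v := by push Not at h; exact h
      simp only [Finset.mem_union, Finset.mem_filter, h, and_false, or_false]
      simp only [eq_true h', and_true]
  · rintro v hv hB ⟨e, he, hve⟩
    simp only [Finset.mem_union, Finset.mem_filter] at he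
    rcases he with he | he
    · exact hB ⟨e, he.1, hve⟩
    · obtain ⟨u, hu, hPu⟩ := he.2
      exact hv (hP e (Finset.mem_union_left _ he.1) u hu v hve hPu)
  · rintro v hv hA ⟨e, he, hve⟩
    simp only [Finset.mem_union, Finset.mem_filter] at he
    rcases he with he | he
    · exact he.2 v hve hv
    · exact hA ⟨e, he.1, hve⟩

/-- A Kempe exchange freeing one of `z`, `z'` from `B` while keeping `x` free. -/
theorem exists_kempe_swap [Fintype V] {S A B : Finset (Sym2 V)} (hA : IsMatchingIn S A)
    (hB : IsMatchingIn S B) {x z z' : V} (hxz : x ≠ z) (hxz' : x ≠ z') (hzz' : z ≠ z')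
    (hx : ¬ IsMatchedBy B x) (hz : ¬ IsMatchedBy A z) (hz' : ¬ IsMatchedBy A z') :
    ∃ A' B', IsMatchingIn S A' ∧ IsMatchingIn S B' ∧
      (∀ e, (if e ∈ A' then 1 else 0) + (if e ∈ B' then 1 else 0) =
        (if e ∈ A then 1 else 0) + (if e ∈ B then 1 else 0 : ℕ)) ∧
      ¬ IsMatchedBy B' x ∧ (¬ IsMatchedBy B' z ∨ ¬ IsMatchedBy B' z') := by
  classical
  -- In the union of two matchings all degrees are at most 2, and `x`, `z`, `z'` have degree at most
  -- 1, each being missed by one of the matchings. So `z` or `z'` lies outside the component of `x`,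
  -- and exchanging on its component leaves `x` untouched.
  let F := SimpleGraph.fromEdgeSet ((A ∪ B : Finset (Sym2 V)) : Set (Sym2 V))
  have closed : ∀ r, ∀ e ∈ A ∪ B, ∀ u ∈ e, ∀ v ∈ e, F.Reachable r u → F.Reachable r v := by
    intro r e he u hu v hv hr
    by_cases huv : u = v
    · rwa [← huv]
    · have : e = s(u, v) := (Sym2.mem_and_mem_iff huv).1 ⟨hu, hv⟩
      refine hr.trans (SimpleGraph.Adj.reachable ?_)
      rw [SimpleGraph.fromEdgeSet_adj]
      exact ⟨by rw [← this]; exact he, huv⟩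
  have main : ∀ r, ¬ IsMatchedBy A r → ¬ F.Reachable r x → ∃ A' B', IsMatchingIn S A' ∧
      IsMatchingIn S B' ∧ (∀ e, (if e ∈ A' then 1 else 0) + (if e ∈ B' then 1 else 0) =
        (if e ∈ A then 1 else 0) + (if e ∈ B then 1 else 0 : ℕ)) ∧
      ¬ IsMatchedBy B' x ∧ ¬ IsMatchedBy B' r := by
    intro r hr hrx
    obtain ⟨A', B', h1, h2, h3, h4, h5⟩ := exists_swap_of_closed hA hB _ (closed r)
    exact ⟨A', B', h1, h2, h3, h4 x hrx hx, h5 r (SimpleGraph.Reachable.refl _) hr⟩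
  by_cases r1 : F.Reachable z x
  · by_cases r2 : F.Reachable z' x
    · exfalso
      have one : ∀ M : Finset (Sym2 V), IsMatchingIn S M → ∀ v,
          (Finset.univ.filter fun u => s(v, u) ∈ M).card ≤ 1 := by
        intro M hM v
        rw [Finset.card_le_one]
        intro a ha b hb
        simp only [Finset.mem_filter, Finset.mem_univ, true_and] at ha hb
        have := hM.2 _ ha _ hb v (by simp) (by simp)
        exact (Sym2.congr_right).1 this
      have zero : ∀ M : Finset (Sym2 V), ∀ v, ¬ IsMatchedBy M v →
          (Finset.univ.filter fun u => s(v, u) ∈ M).card = 0 := by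
        intro M v hv
        rw [Finset.card_eq_zero, Finset.filter_eq_empty_iff]
        intro u _ hu
        exact hv ⟨_, hu, by simp⟩
      have deg : ∀ v, F.degree v ≤ (Finset.univ.filter fun u => s(v, u) ∈ A).card +
          (Finset.univ.filter fun u => s(v, u) ∈ B).card := by
        intro v
        rw [← SimpleGraph.card_neighborFinset_eq_degree]
        refine (Finset.card_le_card ?_).trans (Finset.card_union_le _ _)
        intro u hu
        rw [SimpleGraph.mem_neighborFinset, SimpleGraph.fromEdgeSet_adj] at hu
        have := hu.1
        simpa [Finset.mem_union] using this
      refine not_reachable_of_degree_le F (fun v => ?_) hxz hxz' hzz' ?_ ?_ ?_ r1 r2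
      · have := deg v; have := one A hA v; have := one B hB v; omega
      · have := deg x; have := one A hA x; have := zero B x hx; omega
      · have := deg z; have := zero A z hz; have := one B hB z; omega
      · have := deg z'; have := zero A z' hz'; have := one B hB z'; omega
    · obtain ⟨A', B', h1, h2, h3, h4, h5⟩ := main z' hz' r2
      exact ⟨A', B', h1, h2, h3, h4, Or.inr h5⟩
  · obtain ⟨A', B', h1, h2, h3, h4, h5⟩ := main z hz r1
    exact ⟨A', B', h1, h2, h3, h4, Or.inl h5⟩

end Kempe

section EdgeColoring

variable {V : Type*} [DecidableEq V] {n : ℕ}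

theorem sum_eq_sum_add_of_pair {f g : Fin n → ℕ} {i j : Fin n} (hij : i ≠ j) (k : ℕ)
    (h : f i + f j = g i + g j + k) (hfg : ∀ l, l ≠ i → l ≠ j → f l = g l) :
    ∑ l, f l = ∑ l, g l + k := by
  rw [← Finset.sum_add_sum_compl {i, j} f, ← Finset.sum_add_sum_compl {i, j} g,
    Finset.sum_pair hij, Finset.sum_pair hij, h]
  have : ∑ l ∈ {i, j}ᶜ, f l = ∑ l ∈ {i, j}ᶜ, g l := Finset.sum_congr rfl fun l hl => by
    simp only [Finset.mem_compl, Finset.mem_insert, Finset.mem_singleton, not_or] at hl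
    exact hfg l hl.1 hl.2
  omega

/-- The number of matchings of the family `c` that contain `e`. -/
def colorCount (c : Fin n → Finset (Sym2 V)) (e : Sym2 V) : ℕ :=
  ∑ i, if e ∈ c i then 1 else 0

theorem colorCount_eq_of_pair {c c' : Fin n → Finset (Sym2 V)} {i j : Fin n} (hij : i ≠ j)
    (e : Sym2 V) (k : ℕ)
    (h : (if e ∈ c' i then 1 else 0) + (if e ∈ c' j then 1 else 0) =
      (if e ∈ c i then 1 else 0) + (if e ∈ c j then 1 else 0) + k)
    (hc : ∀ l, l ≠ i → l ≠ j → c' l = c l) : colorCount c' e = colorCount c e + k :=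
  sum_eq_sum_add_of_pair (f := fun l => if e ∈ c' l then 1 else 0)
    (g := fun l => if e ∈ c l then 1 else 0) hij k h fun l h1 h2 => by simp only [hc l h1 h2]

/-- If `x y` can be coloured `i` after moving `x z` from colour `i` to colour `j`, do so. -/
theorem exists_recolor {S : Finset (Sym2 V)} {c : Fin n → Finset (Sym2 V)}
    (hc : ∀ i, IsMatchingIn S (c i)) {x y z : V} (hyz : y ≠ z)
    (hS : s(x, y) ∈ S) {i j : Fin n} (hi : s(x, z) ∈ c i) (hy : ¬ IsMatchedBy (c i) y)
    (hx : ¬ IsMatchedBy (c j) x) (hz : ¬ IsMatchedBy (c j) z) :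
    ∃ c' : Fin n → Finset (Sym2 V), (∀ l, IsMatchingIn S (c' l)) ∧
      ∀ e, colorCount c' e = colorCount c e + if e = s(x, y) then 1 else 0 := by
  have hij : i ≠ j := by
    rintro rfl
    exact hx ⟨_, hi, by simp⟩
  have ne : s(x, y) ≠ s(x, z) := fun h => hyz (Sym2.congr_right.1 h)
  have hxyi : s(x, y) ∉ c i := fun h => hy ⟨_, h, by simp⟩
  have hxzj : s(x, z) ∉ c j := fun h => hx ⟨_, h, by simp⟩
  refine ⟨Function.update (Function.update c i (insert s(x, y) ((c i).erase s(x, z)))) j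
    (insert s(x, z) (c j)), fun l => ?_, fun e => ?_⟩
  · by_cases hlj : l = j
    · subst hlj
      rw [Function.update_self]
      exact (hc l).insert ((hc i).1 hi) hx hz
    · rw [Function.update_of_ne hlj]
      by_cases hli : l = i
      · subst hli
        rw [Function.update_self]
        refine ((hc l).mono (Finset.erase_subset _ _)).insert hS ?_ ?_
        · rintro ⟨e, he, hxe⟩
          rw [Finset.mem_erase] at he
          exact he.1 ((hc l).2 e he.2 _ hi x hxe (by simp))
        · rintro ⟨e, he, hye⟩
          exact hy ⟨e, Finset.mem_of_mem_erase he, hye⟩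
      · rw [Function.update_of_ne hli]
        exact hc l
  · refine colorCount_eq_of_pair hij e _ ?_ fun l h1 h2 => by
      rw [Function.update_of_ne h2, Function.update_of_ne h1]
    rw [Function.update_self, Function.update_of_ne hij, Function.update_self]
    simp only [Finset.mem_insert, Finset.mem_erase]
    by_cases h1 : e = s(x, y)
    · subst h1
      simp [ne, hxyi, add_comm]
    · by_cases h2 : e = s(x, z)
      · subst h2
        simp [h1, hi, hxzj]
      · simp [h1, h2]

open Classical in
/-- The colours that are missing at `v`. -/
noncomputable def missing (c : Fin n → Finset (Sym2 V)) (v : V) : Finset (Fin n) :=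
  Finset.univ.filter fun i => ¬ IsMatchedBy (c i) v

theorem mem_missing {V : Type*} {c : Fin n → Finset (Sym2 V)} {v : V} {i : Fin n} :
    i ∈ missing c v ↔ ¬ IsMatchedBy (c i) v := by
  simp [missing]

/-- With enough colours missing at each vertex, one more copy of the edge `x y` can be coloured. -/
theorem exists_colorCount_succ [Fintype V] {S : Finset (Sym2 V)}
    {c : Fin n → Finset (Sym2 V)} (hc : ∀ i, IsMatchingIn S (c i)) {x y : V}
    (hS : s(x, y) ∈ S) (hd : ∀ e ∈ S, ¬ e.IsDiag) {s m : ℕ} (hs : ∀ v, s ≤ (missing c v).card)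
    (hm : ∀ e ∈ S, colorCount c e ≤ m) (hsm : m * n < s * s) :
    ∃ c' : Fin n → Finset (Sym2 V), (∀ l, IsMatchingIn S (c' l)) ∧
      ∀ e, colorCount c' e = colorCount c e + if e = s(x, y) then 1 else 0 := by
  classical
  by_cases hcom : ∃ i, i ∈ missing c x ∧ i ∈ missing c y
  · obtain ⟨i, hix, hiy⟩ := hcom
    rw [mem_missing] at hix hiy
    refine ⟨Function.update c i (insert s(x, y) (c i)), fun l => ?_, fun e => ?_⟩
    · by_cases hl : l = i
      · subst hl
        rw [Function.update_self]
        exact (hc l).insert hS hix hiy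
      · rw [Function.update_of_ne hl]
        exact hc l
    · have hnot : s(x, y) ∉ c i := fun h => hix ⟨_, h, by simp⟩
      unfold colorCount
      rw [← Finset.add_sum_erase _ _ (Finset.mem_univ i),
        ← Finset.add_sum_erase _ (fun l => if e ∈ c l then 1 else 0) (Finset.mem_univ i),
        Function.update_self]
      rw [Finset.sum_congr (g := fun l => if e ∈ c l then 1 else 0) rfl fun l hl => by
        rw [Function.update_of_ne (Finset.ne_of_mem_erase hl)]]
      by_cases h1 : e = s(x, y)
      · subst h1
        simp [hnot, add_comm]
      · simp [h1]
  · push Not at hcom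
    -- Without a common missing colour, every colour `i` missing at `y` is used at `x`, on some edge
    -- from `x` to `z i`.
    have hpart : ∀ i ∈ missing c y, ∃ z, s(x, z) ∈ c i := by
      intro i hi
      by_contra! hne
      refine hcom i (mem_missing.2 ?_) hi
      rintro ⟨e, he, hxe⟩
      obtain ⟨z, rfl⟩ := hxe
      exact hne z he
    have : Nonempty V := ⟨x⟩
    choose! z hz using hpart
    have hzy : ∀ i ∈ missing c y, y ≠ z i := by
      intro i hi h
      exact mem_missing.1 hi ⟨_, hz i hi, by rw [h]; simp⟩
    have hxz : ∀ i ∈ missing c y, x ≠ z i := by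
      intro i hi h
      exact hd _ ((hc i).1 (hz i hi)) (by rw [← h]; simp)
    -- Double counting of pairs (i, γ) with γ missing at `z i`: there are at least `s * s > m * n`
    -- of them, so some γ serves more than `m` indices. An edge at `x` carries at most `m` colours,
    -- so these indices involve two different neighbours of `x`.
    have hpig : ∃ γ, ∃ i ∈ missing c y, ∃ j ∈ missing c y, γ ∈ missing c (z i) ∧
        γ ∈ missing c (z j) ∧ z i ≠ z j := by
      by_contra! hne
      have hle : ∀ γ, ((missing c y).filter fun i => γ ∈ missing c (z i)).card ≤ m := by
        intro γ
        rcases Finset.eq_empty_or_nonempty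
          ((missing c y).filter fun i => γ ∈ missing c (z i)) with h0 | ⟨i, hi⟩
        · rw [h0]; simp
        · rw [Finset.mem_filter] at hi
          have hsub : ((missing c y).filter fun i => γ ∈ missing c (z i)) ⊆
              Finset.univ.filter fun j => s(x, z i) ∈ c j := by
            intro j hj
            rw [Finset.mem_filter] at hj
            simp only [Finset.mem_filter, Finset.mem_univ, true_and]
            rw [hne γ i hi.1 j hj.1 hi.2 hj.2]
            exact hz j hj.1
          refine (Finset.card_le_card hsub).trans ?_
          have := hm _ ((hc i).1 (hz i hi.1))
          rwa [colorCount, Finset.sum_boole, Nat.cast_id] at this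
      have h1 : s * s ≤ ∑ i ∈ missing c y, (missing c (z i)).card :=
        calc s * s ≤ (missing c y).card * s := Nat.mul_le_mul_right _ (hs y)
          _ = ∑ i ∈ missing c y, s := by simp
          _ ≤ _ := Finset.sum_le_sum fun i _ => hs (z i)
      have h2 : ∑ i ∈ missing c y, (missing c (z i)).card =
          ∑ γ : Fin n, ((missing c y).filter fun i => γ ∈ missing c (z i)).card := by
        have := Finset.sum_card_bipartiteAbove_eq_sum_card_bipartiteBelow
          (s := missing c y) (t := Finset.univ) (fun i γ => γ ∈ missing c (z i))
        simpa [Finset.bipartiteAbove, Finset.bipartiteBelow] using this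
      have h3 : ∑ γ : Fin n, ((missing c y).filter fun i => γ ∈ missing c (z i)).card ≤ n * m :=
        (Finset.sum_le_sum fun γ _ => hle γ).trans (by simp)
      rw [h2] at h1
      have := h1.trans h3
      rw [mul_comm n m] at this
      omega
    obtain ⟨γ, i, hi, j, hj, hγi, hγj, hij⟩ := hpig
    rw [mem_missing] at hγi hγj
    -- If γ is missing at `x`, the edge to `z i` can move to colour γ and release `i` for the new
    -- edge. Otherwise a colour δ missing at `x` is first made missing at `z i` or `z j` by a γ-δ
    -- exchange.
    by_cases hγx : IsMatchedBy (c γ) x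
    · have hpos : 0 < (missing c x).card := by
        have := hs x
        have : 0 < s := by
          rcases Nat.eq_zero_or_pos s with rfl | h
          · simp at hsm
          · exact h
        omega
      obtain ⟨δ, hδ⟩ := Finset.card_pos.1 hpos
      rw [mem_missing] at hδ
      have hγδ : γ ≠ δ := by
        rintro rfl
        exact hδ hγx
      obtain ⟨A', B', hA', hB', hcount, hBx, hor⟩ :=
        exists_kempe_swap (hc γ) (hc δ) (hxz i hi) (hxz j hj) hij hδ hγi hγj
      set c1 := Function.update (Function.update c γ A') δ B' with hc1
      have c1δ : c1 δ = B' := by rw [hc1, Function.update_self]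
      have c1γ : c1 γ = A' := by rw [hc1, Function.update_of_ne hγδ, Function.update_self]
      have c1l : ∀ l, l ≠ γ → l ≠ δ → c1 l = c l := fun l h1 h2 => by
        rw [hc1, Function.update_of_ne h2, Function.update_of_ne h1]
      have hc1m : ∀ l, IsMatchingIn S (c1 l) := by
        intro l
        by_cases h2 : l = δ
        · rw [h2, c1δ]; exact hB'
        · by_cases h1 : l = γ
          · rw [h1, c1γ]; exact hA'
          · rw [c1l l h1 h2]; exact hc l
      have hmult : ∀ e, colorCount c1 e = colorCount c e := fun e => by
        have := colorCount_eq_of_pair (c := c) (c' := c1) hγδ e 0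
          (by rw [c1γ, c1δ]; simpa using hcount e) c1l
        simpa using this
      -- The colour `k` is neither γ nor δ, so the exchange leaves its class intact: it still
      -- contains the edge from `x` to `z k` and still misses `y`.
      have fin : ∀ k ∈ missing c y, ¬ IsMatchedBy (c γ) (z k) → ¬ IsMatchedBy B' (z k) →
          ∃ c' : Fin n → Finset (Sym2 V), (∀ l, IsMatchingIn S (c' l)) ∧
          ∀ e, colorCount c' e = colorCount c e + if e = s(x, y) then 1 else 0 := by
        intro k hk hγk hBk
        have hk1 : k ≠ γ := by
          rintro rfl
          exact hγk ⟨_, hz k hk, by simp⟩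
        have hk2 : k ≠ δ := by
          rintro rfl
          exact hδ ⟨_, hz k hk, by simp⟩
        have hck := c1l k hk1 hk2
        simp only [← hmult]
        refine exists_recolor hc1m (hzy k hk) hS (i := k) (j := δ) ?_ ?_ ?_ ?_
        · rw [hck]; exact hz k hk
        · rw [hck]; exact mem_missing.1 hk
        · rwa [c1δ]
        · rwa [c1δ]
      rcases hor with h | h
      · exact fin i hi hγi h
      · exact fin j hj hγj h
    · exact exists_recolor hc (hzy i hi) hS (hz i hi) (mem_missing.1 hi) hγx hγi

/-- A demand whose degrees leave `s` of `n` colours free, `s ^ 2` exceeding `n` times the largest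
demand, is met exactly by a family of `n` matchings. -/
theorem exists_matchings_of_demand [Fintype V] {S : Finset (Sym2 V)} (hd : ∀ e ∈ S, ¬ e.IsDiag)
    (d : Sym2 V → ℕ) {s m : ℕ} (hs : ∀ v, ∑ e ∈ S with v ∈ e, d e + s ≤ n)
    (hm : ∀ e ∈ S, d e ≤ m) (hsm : m * n < s * s) :
    ∃ c : Fin n → Finset (Sym2 V), (∀ l, IsMatchingIn S (c l)) ∧
      ∀ e ∈ S, colorCount c e = d e := by
  classical
  -- Extremal choice: a family within the demand of largest total size must meet it, since
  -- `exists_colorCount_succ` extends any family that falls short.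
  let T : Finset (Fin n → Finset (Sym2 V)) := Finset.univ.filter fun c =>
    (∀ l, IsMatchingIn S (c l)) ∧ ∀ e ∈ S, colorCount c e ≤ d e
  have hT : T.Nonempty := by
    refine ⟨fun _ => ∅, ?_⟩
    simp only [T, Finset.mem_filter, Finset.mem_univ, true_and]
    exact ⟨fun _ => ⟨by simp, by simp⟩, fun e _ => by simp [colorCount]⟩
  obtain ⟨c, hcT, hmax⟩ := T.exists_max_image (fun c => ∑ e ∈ S, colorCount c e) hT
  simp only [T, Finset.mem_filter, Finset.mem_univ, true_and] at hcT hmax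
  refine ⟨c, hcT.1, ?_⟩
  by_contra! hne
  obtain ⟨e, heS, he⟩ := hne
  have hlt : colorCount c e < d e := lt_of_le_of_ne (hcT.2 e heS) he
  induction e with | _ x y =>
  have hmiss : ∀ v, s ≤ (missing c v).card := by
    intro v
    have h1 : (missing c v).card + (Finset.univ.filter fun i => IsMatchedBy (c i) v).card = n := by
      have := Finset.card_filter_add_card_filter_not (s := (Finset.univ : Finset (Fin n)))
        (fun i => IsMatchedBy (c i) v)
      rw [Finset.card_univ, Fintype.card_fin] at this
      unfold missing
      omega
    have h2 : (Finset.univ.filter fun i => IsMatchedBy (c i) v).card ≤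
        ∑ e ∈ S with v ∈ e, colorCount c e := by
      unfold colorCount
      rw [Finset.sum_comm, Finset.card_filter]
      refine Finset.sum_le_sum fun i _ => ?_
      split_ifs with hi
      · obtain ⟨e, he, hve⟩ := hi
        have : (if e ∈ c i then 1 else 0) ≤ ∑ e ∈ S with v ∈ e, if e ∈ c i then 1 else 0 :=
          Finset.single_le_sum (f := fun e => if e ∈ c i then 1 else 0) (fun _ _ => Nat.zero_le _)
            (Finset.mem_filter.2 ⟨(hcT.1 i).1 he, hve⟩)
        simpa [he] using this
      · exact Nat.zero_le _
    have h3 : ∑ e ∈ S with v ∈ e, colorCount c e ≤ ∑ e ∈ S with v ∈ e, d e :=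
      Finset.sum_le_sum fun e he => hcT.2 e (Finset.mem_filter.1 he).1
    have := hs v
    omega
  obtain ⟨c', hc', hmult⟩ := exists_colorCount_succ hcT.1 heS hd hmiss
    (fun e he => (hcT.2 e he).trans (hm e he)) hsm
  have := hmax c' ⟨hc', fun e he => by
    rw [hmult]
    split_ifs with h
    · rw [h]; omega
    · exact hcT.2 e he⟩
  refine absurd this (not_le.2 ?_)
  simp only [hmult, Finset.sum_add_distrib]
  rw [Finset.sum_ite_eq' S s(x, y), if_pos heS]
  omega

end EdgeColoring

/-- A fractional matching with small entries has almost the weight of an integral one. -/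
theorem exists_matching_of_fractional {V : Type*} [Fintype V] [DecidableEq V]
    {S : Finset (Sym2 V)} (hd : ∀ e ∈ S, ¬ e.IsDiag) (w y : Sym2 V → ℝ)
    (hw : ∀ e ∈ S, 0 ≤ w e) (hy : ∀ e ∈ S, 0 ≤ y e) {η σ : ℝ} (hη : ∀ e ∈ S, y e ≤ η)
    (hη0 : 0 ≤ η) (hσ : 0 < σ) (hησ : η * (1 + σ) < σ ^ 2)
    (hdeg : ∀ v, ∑ e ∈ S with v ∈ e, y e ≤ 1) :
    ∃ M, IsMatchingIn S M ∧ ∑ e ∈ S, y e * w e ≤ (1 + σ) * ∑ e ∈ M, w e := by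
  classical
  obtain ⟨M, hM, hmax⟩ := (Finset.univ.filter fun M => IsMatchingIn S M).exists_max_image
    (fun M => ∑ e ∈ M, w e) ⟨∅, Finset.mem_filter.2 ⟨Finset.mem_univ _, by simp, by simp⟩⟩
  simp only [Finset.mem_filter, Finset.mem_univ, true_and] at hM hmax
  refine ⟨M, hM, ?_⟩
  by_contra! hlt
  set W := ∑ e ∈ M, w e
  set Y := ∑ e ∈ S, y e * w e
  have hW : 0 ≤ W := Finset.sum_nonneg fun e he => hw e (hM.1 he)
  -- With demand `⌊L * y e⌋₊` and `L + s` colours, the best class has weight at least about Y / (1 +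
  -- σ). All rounding errors are bounded independently of `L`, up to the factor `L` in `m * (L +
  -- s)`; a large `L` lets the strict inequalities `hlt` and `hησ` absorb them.
  obtain ⟨L, hL⟩ := exists_nat_gt (max ((3 * W + ∑ e ∈ S, w e) / (Y - (1 + σ) * W))
    (max (3 * η / (σ ^ 2 - η * (1 + σ))) 0))
  have hL1 := (le_max_left _ _).trans_lt hL
  have hL2 := ((le_max_left _ _).trans (le_max_right _ _)).trans_lt hL
  have hL0 : (0 : ℝ) < L := ((le_max_right _ _).trans (le_max_right _ _)).trans_lt hL
  rw [div_lt_iff₀ (by linarith)] at hL1 hL2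
  set s := ⌈σ * L⌉₊
  set m := ⌊η * L⌋₊
  have hs1 : σ * L ≤ s := Nat.le_ceil _
  have hs2 : (s : ℝ) < σ * L + 1 := Nat.ceil_lt_add_one (by positivity)
  have hm1 : (m : ℝ) ≤ η * L := Nat.floor_le (by positivity)
  have hdl : ∀ e ∈ S, ((⌊L * y e⌋₊ : ℕ) : ℝ) ≤ L * y e := fun e he =>
    Nat.floor_le (mul_nonneg hL0.le (hy e he))
  obtain ⟨c, hc, hmult⟩ := exists_matchings_of_demand (n := L + s) hd
    (fun e => ⌊L * y e⌋₊) (s := s) (m := m) (fun v => by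
      have h : ((∑ e ∈ S with v ∈ e, ⌊L * y e⌋₊ : ℕ) : ℝ) ≤ L := by
        push_cast
        calc ∑ e ∈ S with v ∈ e, ((⌊L * y e⌋₊ : ℕ) : ℝ) ≤ ∑ e ∈ S with v ∈ e, L * y e :=
              Finset.sum_le_sum fun e he => hdl e (Finset.mem_filter.1 he).1
          _ = L * ∑ e ∈ S with v ∈ e, y e := by rw [Finset.mul_sum]
          _ ≤ L * 1 := mul_le_mul_of_nonneg_left (hdeg v) hL0.le
          _ = L := mul_one _
      have : ∑ e ∈ S with v ∈ e, ⌊L * y e⌋₊ ≤ L := by exact_mod_cast h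
      omega)
    (fun e he => Nat.floor_le_floor (by
      rw [mul_comm]; exact mul_le_mul_of_nonneg_right (hη e he) hL0.le))
    (by
      have : ((m * (L + s) : ℕ) : ℝ) < ((s * s : ℕ) : ℝ) := by
        push_cast
        calc (m : ℝ) * (L + s) ≤ η * L * (L + (σ * L + 1)) := by gcongr
          _ = L * (η * (1 + σ) * L + η) := by ring
          _ < L * (σ ^ 2 * L) := by
            refine mul_lt_mul_of_pos_left ?_ hL0
            linarith
          _ = (σ * L) * (σ * L) := by ring
          _ ≤ s * s := by gcongr
      exact_mod_cast this)
  have h1 : ∑ l, ∑ e ∈ c l, w e = ∑ e ∈ S, (⌊L * y e⌋₊ : ℝ) * w e := by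
    have : ∀ l, ∑ e ∈ c l, w e = ∑ e ∈ S, (if e ∈ c l then 1 else 0) * w e := by
      intro l
      simp only [ite_mul, one_mul, zero_mul]
      rw [← Finset.sum_filter, Finset.filter_mem_eq_inter, Finset.inter_eq_right.2 (hc l).1]
    rw [Finset.sum_congr rfl fun l _ => this l, Finset.sum_comm]
    refine Finset.sum_congr rfl fun e he => ?_
    rw [← Finset.sum_mul, ← hmult e he, colorCount]
    push_cast
    rfl
  have h2 : ∑ l, ∑ e ∈ c l, w e ≤ (L + s) * W := by
    calc ∑ l, ∑ e ∈ c l, w e ≤ ∑ _l : Fin (L + s), W :=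
          Finset.sum_le_sum fun l _ => hmax (c l) (hc l)
      _ = _ := by simp
  have h3 : L * Y - ∑ e ∈ S, w e ≤ ∑ e ∈ S, (⌊L * y e⌋₊ : ℝ) * w e := by
    rw [Finset.mul_sum, ← Finset.sum_sub_distrib]
    refine Finset.sum_le_sum fun e he => ?_
    have := (Nat.lt_floor_add_one (L * y e)).le
    nlinarith [hw e he]
  nlinarith

/-! ### Expectation, variance and independent samples on finite types -/

namespace PMF

section Expect

variable {Ω Ω' : Type*} [Fintype Ω] [Fintype Ω'] (d : PMF Ω)

theorem sum_toReal : ∑ ω, (d ω).toReal = 1 := by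
  rw [← ENNReal.toReal_sum fun ω _ => d.apply_ne_top ω, ← tsum_fintype (L := .unconditional Ω),
    d.tsum_coe, ENNReal.toReal_one]

theorem expect_add (f g : Ω → ℝ) : d.expect (fun ω => f ω + g ω) = d.expect f + d.expect g := by
  simp only [expect, mul_add, Finset.sum_add_distrib]

theorem expect_sub (f g : Ω → ℝ) : d.expect (fun ω => f ω - g ω) = d.expect f - d.expect g := by
  simp only [expect, mul_sub, Finset.sum_sub_distrib]

theorem expect_const_mul (c : ℝ) (f : Ω → ℝ) : d.expect (fun ω => c * f ω) = c * d.expect f := by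
  simp only [expect, Finset.mul_sum]
  exact Finset.sum_congr rfl fun _ _ => by ring

theorem expect_mul_const (c : ℝ) (f : Ω → ℝ) : d.expect (fun ω => f ω * c) = d.expect f * c := by
  simp only [expect, Finset.sum_mul]
  exact Finset.sum_congr rfl fun _ _ => by ring

theorem expect_div_const (c : ℝ) (f : Ω → ℝ) : d.expect (fun ω => f ω / c) = d.expect f / c := by
  simp only [div_eq_mul_inv, expect_mul_const]

theorem expect_const (c : ℝ) : d.expect (fun _ => c) = c := by
  simp only [expect, ← Finset.sum_mul, d.sum_toReal, one_mul]

theorem expect_sum {ι : Type*} (s : Finset ι) (f : ι → Ω → ℝ) :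
    d.expect (fun ω => ∑ i ∈ s, f i ω) = ∑ i ∈ s, d.expect (f i) := by
  simp only [expect, Finset.mul_sum]
  exact Finset.sum_comm

theorem expect_mono_support {f g : Ω → ℝ} (h : ∀ ω ∈ d.support, f ω ≤ g ω) :
    d.expect f ≤ d.expect g := by
  refine Finset.sum_le_sum fun ω _ => ?_
  by_cases hω : d ω = 0
  · simp [hω]
  · exact mul_le_mul_of_nonneg_left (h ω hω) ENNReal.toReal_nonneg

theorem expect_congr_support {f g : Ω → ℝ} (h : ∀ ω ∈ d.support, f ω = g ω) :
    d.expect f = d.expect g :=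
  le_antisymm (d.expect_mono_support fun ω hω => (h ω hω).le)
    (d.expect_mono_support fun ω hω => (h ω hω).ge)

theorem expect_mono {f g : Ω → ℝ} (h : ∀ ω, f ω ≤ g ω) : d.expect f ≤ d.expect g :=
  d.expect_mono_support fun ω _ => h ω

theorem expect_nonneg {f : Ω → ℝ} (h : ∀ ω, 0 ≤ f ω) : 0 ≤ d.expect f :=
  (d.expect_const 0).ge.trans (d.expect_mono h)

theorem expect_pure (a : Ω) (f : Ω → ℝ) : (PMF.pure a).expect f = f a := by
  classical
  rw [expect, Finset.sum_eq_single a]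
  · simp
  · intro b _ hb
    simp [hb]
  · simp

theorem expect_bind (k : Ω → PMF Ω') (f : Ω' → ℝ) :
    (d.bind k).expect f = d.expect fun ω => (k ω).expect f := by
  simp only [expect, bind_apply, tsum_fintype, Finset.mul_sum]
  rw [Finset.sum_comm]
  refine Finset.sum_congr rfl fun ω' _ => ?_
  rw [ENNReal.toReal_sum fun ω _ => ENNReal.mul_ne_top (d.apply_ne_top ω) ((k ω).apply_ne_top ω'),
    Finset.sum_mul]
  exact Finset.sum_congr rfl fun ω _ => by rw [ENNReal.toReal_mul, mul_assoc]

theorem expect_map (k : Ω → Ω') (f : Ω' → ℝ) :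
    (d.map k).expect f = d.expect fun ω => f (k ω) := by
  rw [← bind_pure_comp, expect_bind]
  simp only [Function.comp_apply, expect_pure]

theorem expect_comm (d' : PMF Ω') (f : Ω → Ω' → ℝ) :
    d.expect (fun ω => d'.expect (f ω)) = d'.expect fun ω' => d.expect fun ω => f ω ω' := by
  simp only [expect, Finset.mul_sum]
  rw [Finset.sum_comm]
  exact Finset.sum_congr rfl fun _ _ => Finset.sum_congr rfl fun _ _ => by ring

/-- Pointwise, |f| is at most θ or at most f² / θ. This turns variances into mean absolute
deviations, with θ left to be chosen later. -/
theorem expect_abs_le (f : Ω → ℝ) {θ : ℝ} (hθ : 0 < θ) :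
    d.expect (fun ω => |f ω|) ≤ θ + d.expect (fun ω => f ω ^ 2) / θ := by
  rw [← d.expect_const θ, ← expect_div_const, ← expect_add, d.expect_const]
  refine d.expect_mono fun ω => ?_
  rw [← sub_le_iff_le_add', le_div_iff₀ hθ, ← sq_abs (f ω)]
  nlinarith [sq_nonneg (|f ω| - θ), abs_nonneg (f ω)]

theorem variance_eq (f : Ω → ℝ) :
    d.variance f = d.expect (fun ω => f ω ^ 2) - d.expect f ^ 2 := by
  unfold variance
  have : ∀ ω, (f ω - d.expect f) ^ 2 = f ω ^ 2 - 2 * d.expect f * f ω + d.expect f ^ 2 :=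
    fun ω => by ring
  simp only [this, expect_add, expect_sub, expect_const_mul, expect_const]
  ring

theorem variance_le_expect_sq (f : Ω → ℝ) : d.variance f ≤ d.expect fun ω => f ω ^ 2 := by
  rw [variance_eq]
  nlinarith [sq_nonneg (d.expect f)]

theorem expect_abs_sub_le (f : Ω → ℝ) {θ : ℝ} (hθ : 0 < θ) :
    d.expect (fun ω => |f ω - d.expect f|) ≤ θ + d.variance f / θ :=
  d.expect_abs_le _ hθ

end Expect

open Classical in
/-- The real-valued indicator of a proposition. -/
noncomputable def _root_.indicatorProp (P : Prop) : ℝ := if P then 1 else 0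

section Indicator

variable {P Q : Prop}

theorem _root_.indicatorProp_true (h : P) : indicatorProp P = 1 := if_pos h

theorem _root_.indicatorProp_false (h : ¬ P) : indicatorProp P = 0 := if_neg h

theorem _root_.indicatorProp_nonneg : 0 ≤ indicatorProp P := by
  unfold indicatorProp; split_ifs <;> norm_num

theorem _root_.indicatorProp_le_one : indicatorProp P ≤ 1 := by
  unfold indicatorProp; split_ifs <;> norm_num

theorem _root_.indicatorProp_mono (h : P → Q) : indicatorProp P ≤ indicatorProp Q := by
  unfold indicatorProp; split_ifs <;> first | tauto | norm_num

theorem _root_.indicatorProp_mul_self : indicatorProp P * indicatorProp P = indicatorProp P := by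
  unfold indicatorProp; split_ifs <;> norm_num

theorem _root_.indicatorProp_not : indicatorProp (¬ P) = 1 - indicatorProp P := by
  unfold indicatorProp; split_ifs <;> norm_num

theorem prob_eq_expect {Ω : Type*} [Fintype Ω] (d : PMF Ω) (E : Ω → Prop) :
    d.prob E = d.expect fun ω => indicatorProp (E ω) := rfl

theorem prob_le_one {Ω : Type*} [Fintype Ω] (d : PMF Ω) (E : Ω → Prop) : d.prob E ≤ 1 :=
  (d.expect_mono fun _ => indicatorProp_le_one).trans (d.expect_const 1).le

end Indicator

section Iid

variable {Ω : Type*} [Fintype Ω] (d : PMF Ω)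

theorem sum_prod_toReal (t : ℕ) : ∑ ω : Fin t → Ω, ∏ i, d (ω i) = 1 := by
  rw [← Fintype.piFinset_univ, ← Finset.prod_univ_sum]
  rw [← tsum_fintype (L := .unconditional Ω), d.tsum_coe, Finset.prod_const_one]

/-- The distribution of `t` independent samples from `d`. -/
noncomputable def iid (t : ℕ) : PMF (Fin t → Ω) :=
  PMF.ofFintype (fun ω => ∏ i, d (ω i)) (d.sum_prod_toReal t)

theorem mem_support_of_mem_support_iid {d : PMF Ω} {t : ℕ}
    {D : Fin t → Ω} (hD : D ∈ (d.iid t).support) (i : Fin t) : D i ∈ d.support := by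
  rw [mem_support_iff, iid, ofFintype_apply, Finset.prod_ne_zero_iff] at hD
  exact hD i (Finset.mem_univ i)

/-- Isolating an arbitrary index `i`, not only the first, lets later arguments single out one sample
by symmetry. -/
theorem expect_iid_succ {t : ℕ} (i : Fin (t + 1)) (f : (Fin (t + 1) → Ω) → ℝ) :
    (d.iid (t + 1)).expect f =
      d.expect fun a => (d.iid t).expect fun ω => f (i.insertNth a ω) := by
  unfold expect
  rw [← (Fin.insertNthEquiv (fun _ => Ω) i).sum_comp, Fintype.sum_prod_type]
  refine Finset.sum_congr rfl fun a _ => ?_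
  rw [Finset.mul_sum]
  refine Finset.sum_congr rfl fun ω _ => ?_
  simp only [iid, ofFintype_apply, Fin.insertNthEquiv_apply, Fin.prod_univ_succAbove _ i,
    Fin.insertNth_apply_same, Fin.insertNth_apply_succAbove, ENNReal.toReal_mul]
  exact mul_assoc _ _ _

theorem expect_iid_apply {t : ℕ} (i : Fin t) (f : Ω → ℝ) :
    (d.iid t).expect (fun ω => f (ω i)) = d.expect f := by
  obtain _ | t := t
  · exact i.elim0
  · rw [d.expect_iid_succ i]
    simp only [Fin.insertNth_apply_same, expect_const]

theorem prob_iid_forall (E : Ω → Prop) (t : ℕ) :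
    (d.iid t).prob (fun ω => ∀ i, E (ω i)) = d.prob E ^ t := by
  induction t with
  | zero =>
    rw [prob_eq_expect, pow_zero, ← (d.iid 0).expect_const 1]
    congr 1
    funext ω
    exact indicatorProp_true fun i => i.elim0
  | succ t ih =>
    rw [prob_eq_expect, d.expect_iid_succ 0, pow_succ', ← ih, prob_eq_expect d,
      ← expect_mul_const]
    congr 1
    funext a
    rw [prob_eq_expect, ← expect_const_mul]
    congr 1
    funext ω
    rw [Fin.insertNth_zero', Fin.forall_fin_succ]
    simp only [Fin.cons_zero, Fin.cons_succ]
    by_cases h1 : E a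
    · rw [indicatorProp_true h1, one_mul]
      simp only [h1, true_and]
    · rw [indicatorProp_false h1, zero_mul]
      exact indicatorProp_false fun h => h1 h.1

/-- The average of `g` over the samples `ω`. -/
noncomputable def _root_.sampleMean {t : ℕ} (g : Ω → ℝ) (ω : Fin t → Ω) : ℝ :=
  (∑ i, g (ω i)) / t

theorem expect_sampleMean {t : ℕ} (ht : t ≠ 0) (g : Ω → ℝ) :
    (d.iid t).expect (sampleMean g) = d.expect g := by
  unfold sampleMean
  rw [expect_div_const, expect_sum]
  simp only [d.expect_iid_apply _ g, Finset.sum_const, Finset.card_univ, Fintype.card_fin,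
    nsmul_eq_mul]
  field_simp

/-- Size biasing: conditioned on a sample satisfying `E`, the average of `g` grows by at most
`c / t`. -/
theorem expect_sampleMean_mul_le {t : ℕ} (ht : t ≠ 0) {a g : Ω → ℝ} {c : ℝ}
    (ha : ∀ ω, 0 ≤ a ω) (hg : ∀ ω, 0 ≤ g ω) (hag : ∀ ω, a ω ≠ 0 → g ω ≤ c)
    {h : ℝ → ℝ} (hmono : Monotone h) (hlip : ∀ x y, 0 ≤ y → h (x + y) ≤ h x + y) :
    (d.iid t).expect (fun ω => sampleMean a ω * h (sampleMean g ω)) ≤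
      d.expect a * (c / t + (d.iid t).expect fun ω => h (sampleMean g ω)) := by
  obtain _ | t := t
  · exact absurd rfl ht
  have hT : (0 : ℝ) < ((t + 1 : ℕ) : ℝ) := by positivity
  have hsum : ∀ (i : Fin (t + 1)) b (ω : Fin t → Ω),
      sampleMean g (i.insertNth b ω : Fin (t + 1) → Ω) =
        (∑ j, g (ω j)) / ((t + 1 : ℕ) : ℝ) + g b / ((t + 1 : ℕ) : ℝ) := by
    intro i b ω
    rw [sampleMean, Fin.sum_univ_succAbove _ i]
    simp only [Fin.insertNth_apply_same, Fin.insertNth_apply_succAbove]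
    ring
  -- Fix the `i`-th sample `b`. If `a b` is nonzero, that sample contributes at most `c / (t + 1)`
  -- to the mean of `g`; the rest is independent of `b` and, by monotonicity, bounded by the full
  -- mean.
  have key : ∀ i : Fin (t + 1), (d.iid (t + 1)).expect (fun ω => a (ω i) * h (sampleMean g ω)) ≤
      d.expect a * (c / (t + 1 : ℕ) + (d.iid (t + 1)).expect fun ω => h (sampleMean g ω)) := by
    intro i
    have h1 : (d.iid t).expect (fun ω => h ((∑ j, g (ω j)) / ((t + 1 : ℕ) : ℝ))) ≤
        (d.iid (t + 1)).expect fun ω => h (sampleMean g ω) := by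
      rw [d.expect_iid_succ i, ← d.expect_const ((d.iid t).expect _)]
      refine d.expect_mono fun b => (d.iid t).expect_mono fun ω => hmono ?_
      rw [hsum]
      have := div_nonneg (hg b) hT.le
      linarith
    rw [d.expect_iid_succ i, ← expect_mul_const]
    refine d.expect_mono fun b => ?_
    simp only [Fin.insertNth_apply_same]
    rw [expect_const_mul]
    rcases eq_or_ne (a b) 0 with h0 | h0
    · rw [h0, zero_mul, zero_mul]
    · refine mul_le_mul_of_nonneg_left ?_ (ha b)
      refine le_trans ?_ (add_le_add le_rfl h1)
      rw [← (d.iid t).expect_const (c / _), ← expect_add]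
      refine (d.iid t).expect_mono fun ω => ?_
      rw [hsum]
      have h2 := hlip ((∑ j, g (ω j)) / ((t + 1 : ℕ) : ℝ)) _ (div_nonneg (hg b) hT.le)
      have h3 : g b / ((t + 1 : ℕ) : ℝ) ≤ c / ((t + 1 : ℕ) : ℝ) := by
        have := hag b h0
        gcongr
      linarith
  have : ∀ ω : Fin (t + 1) → Ω, sampleMean a ω * h (sampleMean g ω) =
      (∑ i, a (ω i) * h (sampleMean g ω)) / ((t + 1 : ℕ) : ℝ) := by
    intro ω
    rw [← Finset.sum_mul]
    simp only [sampleMean]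
    ring
  simp only [this]
  rw [expect_div_const, expect_sum, div_le_iff₀ hT]
  refine (Finset.sum_le_sum fun i _ => key i).trans (le_of_eq ?_)
  rw [Finset.sum_const, Finset.card_univ, Fintype.card_fin, nsmul_eq_mul, mul_comm]

theorem expect_iid_mul {t : ℕ} {i j : Fin t} (hij : i ≠ j) (f g : Ω → ℝ) :
    (d.iid t).expect (fun ω => f (ω i) * g (ω j)) = d.expect f * d.expect g := by
  obtain _ | t := t
  · exact i.elim0
  · obtain ⟨k, rfl⟩ := Fin.exists_succAbove_eq hij.symm
    rw [d.expect_iid_succ i]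
    simp only [Fin.insertNth_apply_same, Fin.insertNth_apply_succAbove, expect_const_mul,
      d.expect_iid_apply k g, expect_mul_const]

/-- Independence kills the mixed terms, and each diagonal term is at most E[g²] ≤ B E[g]. Keeping
the factor E[g] instead of a second `B` matters, because `B` will be of order 1/p. -/
theorem variance_sampleMean_le {t : ℕ} (ht : t ≠ 0) {g : Ω → ℝ} {B : ℝ} (hg : ∀ ω, 0 ≤ g ω)
    (hB : ∀ ω, g ω ≤ B) : (d.iid t).variance (sampleMean g) ≤ B * d.expect g / t := by
  have hT : (0 : ℝ) < t := by positivity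
  set m := d.expect g with hm
  have hsq : ∀ ω : Fin t → Ω, (sampleMean g ω - m) ^ 2 =
      (∑ i, ∑ j, (g (ω i) - m) * (g (ω j) - m)) / (t : ℝ) ^ 2 := by
    intro ω
    rw [← Finset.sum_mul_sum, Finset.sum_sub_distrib, Finset.sum_const, Finset.card_univ,
      Fintype.card_fin, nsmul_eq_mul, sampleMean]
    field_simp
  have h0 : d.expect (fun ω => g ω - m) = 0 := by
    rw [expect_sub, expect_const, hm, sub_self]
  have hvar : d.expect (fun ω => (g ω - m) * (g ω - m)) ≤ B * m := by
    have h1 := d.variance_le_expect_sq g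
    unfold variance at h1
    simp only [← hm, sq] at h1
    refine h1.trans ?_
    rw [hm, ← expect_const_mul]
    exact d.expect_mono fun ω => mul_le_mul_of_nonneg_right (hB ω) (hg ω)
  unfold variance
  rw [d.expect_sampleMean ht]
  simp only [← hm, hsq]
  rw [expect_div_const, expect_sum]
  have hrow : ∀ i : Fin t,
      (d.iid t).expect (fun ω => ∑ j, (g (ω i) - m) * (g (ω j) - m)) ≤ B * m := by
    intro i
    rw [expect_sum, Finset.sum_eq_single i]
    · rw [d.expect_iid_apply i fun ω => (g ω - m) * (g ω - m)]
      exact hvar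
    · intro j _ hj
      rw [d.expect_iid_mul hj.symm (fun ω => g ω - m) fun ω => g ω - m, h0, zero_mul]
    · simp
  rw [div_le_div_iff₀ (by positivity) hT]
  have := Finset.sum_le_sum fun i (_ : i ∈ Finset.univ) => hrow i
  rw [Finset.sum_const, Finset.card_univ, Fintype.card_fin, nsmul_eq_mul] at this
  nlinarith

end Iid

end PMF

/-! ### The product measure on realizations, and the law of the queried set -/

theorem edgeDegree_eq {V : Type*} (Q : Finset (Sym2 V)) (v : V)
    [DecidablePred fun e : Sym2 V => v ∈ e] :
    edgeDegree Q v = (Q.filter fun e => v ∈ e).card := by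
  unfold edgeDegree
  congr

namespace StochGraph

variable {V : Type u} [Fintype V]

theorem mem_edges_p_pos (I : StochGraph V) {e : Sym2 V} (he : e ∈ I.edges) : 0 < I.p e :=
  I.p_pos e ((I.mem_edges e).1 he)

theorem mem_edges_p_le_one (I : StochGraph V) {e : Sym2 V} (he : e ∈ I.edges) : I.p e ≤ 1 :=
  I.p_le_one e ((I.mem_edges e).1 he)

theorem mem_edges_w_nonneg (I : StochGraph V) {e : Sym2 V} (he : e ∈ I.edges) : 0 ≤ I.w e :=
  I.w_nonneg e ((I.mem_edges e).1 he)

theorem pmin_le (I : StochGraph V) {e : Sym2 V} (he : e ∈ I.edges) : I.pmin ≤ I.p e :=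
  ciInf_le (Set.finite_range fun e : I.G.edgeSet => I.p e).bddBelow
    (⟨e, (I.mem_edges e).1 he⟩ : I.G.edgeSet)

theorem pmin_pos (I : StochGraph V) {e : Sym2 V} (he : e ∈ I.edges) : 0 < I.pmin := by
  have : Nonempty I.G.edgeSet := ⟨⟨e, (I.mem_edges e).1 he⟩⟩
  obtain ⟨f, hf⟩ := exists_eq_ciInf_of_finite (f := fun e : I.G.edgeSet => I.p e)
  rw [pmin, ← hf]
  exact I.p_pos f f.2

section Restrict

/-- The weighted stochastic graph formed by the edges of `I` that lie in `C`. -/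
def restrict (I : StochGraph V) (C : Finset (Sym2 V)) : StochGraph V where
  G := SimpleGraph.fromEdgeSet (I.G.edgeSet ∩ C)
  w := I.w
  p := I.p
  w_nonneg e he := I.w_nonneg e (by
    rw [SimpleGraph.edgeSet_fromEdgeSet] at he
    exact he.1.1)
  p_pos e he := I.p_pos e (by
    rw [SimpleGraph.edgeSet_fromEdgeSet] at he
    exact he.1.1)
  p_le_one e he := I.p_le_one e (by
    rw [SimpleGraph.edgeSet_fromEdgeSet] at he
    exact he.1.1)

theorem not_isDiag_of_mem_edges (I : StochGraph V) {e : Sym2 V} (he : e ∈ I.edges) :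
    ¬ e.IsDiag :=
  I.G.not_isDiag_of_mem_edgeSet ((I.mem_edges e).1 he)

theorem edges_restrict (I : StochGraph V) {C : Finset (Sym2 V)} (hC : C ⊆ I.edges) :
    (I.restrict C).edges = C := by
  ext e
  rw [mem_edges, restrict, SimpleGraph.edgeSet_fromEdgeSet]
  constructor
  · rintro ⟨⟨_, h⟩, _⟩
    exact h
  · intro h
    exact ⟨⟨(I.mem_edges e).1 (hC h), h⟩, I.not_isDiag_of_mem_edges (hC h)⟩

end Restrict

variable [DecidableEq V]

theorem realization_expect (I : StochGraph V) (f : Finset (Sym2 V) → ℝ) :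
    I.realization.expect f = ∑ S, I.mass S * f S := by
  unfold PMF.expect realization
  simp only [PMF.ofFintype_apply, ENNReal.toReal_ofReal (I.mass_nonneg _)]

theorem subset_of_mem_support (I : StochGraph V) {S : Finset (Sym2 V)}
    (hS : S ∈ I.realization.support) : S ⊆ I.edges := by
  by_contra h
  rw [PMF.mem_support_iff, realization, PMF.ofFintype_apply, mass, if_neg h] at hS
  simp at hS

theorem mass_union (I : StochGraph V) {C S T : Finset (Sym2 V)} (hC : C ⊆ I.edges) (hS : S ⊆ C)
    (hT : T ⊆ I.edges \ C) :
    I.mass (S ∪ T) = (I.restrict C).mass S * (I.restrict (I.edges \ C)).mass T := by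
  have hST : Disjoint S T := Finset.disjoint_of_subset_left hS
    (Finset.disjoint_of_subset_right hT Finset.disjoint_sdiff)
  have hsub : S ∪ T ⊆ I.edges :=
    Finset.union_subset (hS.trans hC) (hT.trans Finset.sdiff_subset)
  have hcompl : I.edges \ (S ∪ T) = (C \ S) ∪ ((I.edges \ C) \ T) := by
    ext e
    have h1 := @hC e
    have h2 := @hS e
    have h3 := @hT e
    simp only [Finset.mem_sdiff, Finset.mem_union] at h3 ⊢
    tauto
  have hdisj : Disjoint (C \ S) ((I.edges \ C) \ T) :=
    Finset.disjoint_of_subset_left Finset.sdiff_subset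
      (Finset.disjoint_of_subset_right Finset.sdiff_subset Finset.disjoint_sdiff)
  unfold mass
  rw [I.edges_restrict hC, I.edges_restrict Finset.sdiff_subset, if_pos hsub, if_pos hS, if_pos hT,
    hcompl, Finset.prod_union hST, Finset.prod_union hdisj]
  simp only [restrict]
  ring

/-- Independence of the realizations inside and outside `C`: the masses factor by `mass_union`. -/
theorem expect_eq_expect_union (I : StochGraph V) {C : Finset (Sym2 V)} (hC : C ⊆ I.edges)
    (F : Finset (Sym2 V) → ℝ) :
    I.realization.expect F = (I.restrict C).realization.expect fun S =>
      (I.restrict (I.edges \ C)).realization.expect fun T => F (S ∪ T) := by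
  have hsum : ∀ (J : StochGraph V) (f : Finset (Sym2 V) → ℝ),
      J.realization.expect f = ∑ S ∈ J.edges.powerset, J.mass S * f S := by
    intro J f
    rw [realization_expect]
    symm
    refine Finset.sum_subset (Finset.subset_univ _) fun S _ hS => ?_
    rw [mass, if_neg (fun h => hS (Finset.mem_powerset.2 h)), zero_mul]
  simp only [hsum, I.edges_restrict hC, I.edges_restrict (Finset.sdiff_subset (s := I.edges) (t := C)),
    Finset.mul_sum]
  rw [← Finset.sum_product']
  refine Finset.sum_nbij' (fun U => (U ∩ C, U \ C)) (fun q => q.1 ∪ q.2) ?_ ?_ ?_ ?_ ?_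
  · intro U hU
    rw [Finset.mem_powerset] at hU
    simp only [Finset.mem_product, Finset.mem_powerset]
    exact ⟨Finset.inter_subset_right, Finset.sdiff_subset_sdiff hU le_rfl⟩
  · intro q hq
    simp only [Finset.mem_product, Finset.mem_powerset] at hq ⊢
    exact Finset.union_subset (hq.1.trans hC) (hq.2.trans Finset.sdiff_subset)
  · intro U _
    ext e
    simp only [Finset.mem_union, Finset.mem_inter, Finset.mem_sdiff]
    tauto
  · rintro ⟨S, T⟩ hq
    simp only [Finset.mem_product, Finset.mem_powerset] at hq
    ext e
    · have h1 := @hq.1 e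
      have h2 := @hq.2 e
      simp only [Finset.mem_union, Finset.mem_inter, Finset.mem_sdiff] at h2 ⊢
      tauto
    · have h1 := @hq.1 e
      have h2 := @hq.2 e
      simp only [Finset.mem_union, Finset.mem_sdiff] at h2 ⊢
      tauto
  · intro U hU
    rw [Finset.mem_powerset] at hU
    have hU' : U ∩ C ∪ U \ C = U := by
      ext e
      simp only [Finset.mem_union, Finset.mem_inter, Finset.mem_sdiff]
      tauto
    rw [← mul_assoc, ← I.mass_union hC Finset.inter_subset_right
      (Finset.sdiff_subset_sdiff hU le_rfl), hU']

/-- The presence of `e` is independent of the rest; the proof pairs each `S` not containing `e` with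
`insert e S`. -/
theorem expect_mem_mul_erase (I : StochGraph V) {e : Sym2 V} (he : e ∈ I.edges)
    (F : Finset (Sym2 V) → ℝ) :
    I.realization.expect (fun S => indicatorProp (e ∈ S) * F (S.erase e)) =
      I.p e * I.realization.expect fun S => F (S.erase e) := by
  have hsplit : ∀ X : Finset (Sym2 V) → ℝ,
      ∑ S, X S = ∑ S with e ∉ S, (X S + X (insert e S)) := by
    intro X
    rw [← Finset.sum_filter_add_sum_filter_not Finset.univ (fun S => e ∉ S), Finset.sum_add_distrib]
    congr 1
    refine Finset.sum_nbij' (fun S => S.erase e) (fun S => insert e S) ?_ ?_ ?_ ?_ ?_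
    · intro S _; simp
    · intro S _; simp
    · intro S hS
      simp only [Finset.mem_filter, Finset.mem_univ, true_and, not_not] at hS
      exact Finset.insert_erase hS
    · intro S hS
      simp only [Finset.mem_filter, Finset.mem_univ, true_and] at hS
      exact Finset.erase_insert hS
    · intro S hS
      simp only [Finset.mem_filter, Finset.mem_univ, true_and, not_not] at hS
      rw [Finset.insert_erase hS]
  have hmass : ∀ S, e ∉ S → (1 - I.p e) * I.mass (insert e S) = I.p e * I.mass S := by
    intro S heS
    unfold mass
    by_cases hS : S ⊆ I.edges
    · have hcompl : I.edges \ S = insert e (I.edges \ insert e S) := by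
        ext f
        simp only [Finset.mem_sdiff, Finset.mem_insert]
        by_cases hf : f = e
        · subst hf; simp [he, heS]
        · simp [hf]
      rw [if_pos hS, if_pos (Finset.insert_subset he hS), Finset.prod_insert heS, hcompl,
        Finset.prod_insert (by simp)]
      ring
    · rw [if_neg hS, if_neg fun h => hS ((Finset.subset_insert _ _).trans h), mul_zero, mul_zero]
  rw [realization_expect, realization_expect, hsplit, hsplit, Finset.mul_sum]
  refine Finset.sum_congr rfl fun S hS => ?_
  simp only [Finset.mem_filter, Finset.mem_univ, true_and] at hS
  rw [indicatorProp_false hS, indicatorProp_true (Finset.mem_insert_self e S),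
    Finset.erase_insert hS, Finset.erase_eq_of_notMem hS]
  linear_combination F S * hmass S hS

theorem prob_mem (I : StochGraph V) {e : Sym2 V} (he : e ∈ I.edges) :
    I.realization.expect (fun S => indicatorProp (e ∈ S)) = I.p e := by
  have := I.expect_mem_mul_erase he fun _ => 1
  simpa only [mul_one, PMF.expect_const] using this

theorem prob_mem_mem (I : StochGraph V) {e f : Sym2 V} (he : e ∈ I.edges) (hf : f ∈ I.edges)
    (hef : e ≠ f) :
    I.realization.expect (fun S => indicatorProp (e ∈ S) * indicatorProp (f ∈ S)) =
      I.p e * I.p f := by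
  have := I.expect_mem_mul_erase he fun S => indicatorProp (f ∈ S)
  simpa only [Finset.mem_erase, hef.symm, ne_eq, not_false_eq_true, true_and, I.prob_mem hf]
    using this

/-- Size biasing: conditioned on the presence of `e`, the mean of `F` grows by at most `c`. -/
theorem expect_mem_mul_le (I : StochGraph V) {e : Sym2 V} (he : e ∈ I.edges)
    {F : Finset (Sym2 V) → ℝ} {c : ℝ} (h1 : ∀ S, F S ≤ F (S.erase e) + c)
    (h2 : ∀ S, F (S.erase e) ≤ F S) :
    I.realization.expect (fun S => indicatorProp (e ∈ S) * F S) ≤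
      I.p e * (c + I.realization.expect F) := by
  calc I.realization.expect (fun S => indicatorProp (e ∈ S) * F S)
      ≤ I.realization.expect (fun S => indicatorProp (e ∈ S) * (F (S.erase e) + c)) :=
        PMF.expect_mono _ fun S => mul_le_mul_of_nonneg_left (h1 S) indicatorProp_nonneg
    _ = I.p e * I.realization.expect fun S => F (S.erase e) + c :=
        I.expect_mem_mul_erase he fun S => F S + c
    _ ≤ _ := by
        refine mul_le_mul_of_nonneg_left ?_ (I.mem_edges_p_pos he).le
        rw [PMF.expect_add, PMF.expect_const, add_comm]
        exact add_le_add le_rfl (PMF.expect_mono _ h2)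

theorem expect_sum_mem (I : StochGraph V) {s : Finset (Sym2 V)} (hs : s ⊆ I.edges)
    (b : Sym2 V → ℝ) :
    I.realization.expect (fun S => ∑ e ∈ s, b e * indicatorProp (e ∈ S)) =
      ∑ e ∈ s, b e * I.p e := by
  rw [PMF.expect_sum]
  refine Finset.sum_congr rfl fun e he => ?_
  rw [PMF.expect_const_mul, I.prob_mem (hs he)]

/-- Distinct edges are uncorrelated, so only diagonal terms b_e² (p_e − p_e²) remain. -/
theorem variance_sum_mem_le (I : StochGraph V) {s : Finset (Sym2 V)} (hs : s ⊆ I.edges)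
    (b : Sym2 V → ℝ) :
    I.realization.variance (fun S => ∑ e ∈ s, b e * indicatorProp (e ∈ S)) ≤
      ∑ e ∈ s, b e ^ 2 * I.p e := by
  rw [PMF.variance_eq, I.expect_sum_mem hs]
  have hsq : ∀ S : Finset (Sym2 V), (∑ e ∈ s, b e * indicatorProp (e ∈ S)) ^ 2 =
      ∑ e ∈ s, ∑ f ∈ s, b e * b f * (indicatorProp (e ∈ S) * indicatorProp (f ∈ S)) := by
    intro S
    rw [sq, Finset.sum_mul_sum]
    exact Finset.sum_congr rfl fun e _ => Finset.sum_congr rfl fun f _ => by ring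
  simp only [hsq]
  rw [PMF.expect_sum, sq, Finset.sum_mul_sum, ← Finset.sum_sub_distrib]
  refine Finset.sum_le_sum fun e he => ?_
  rw [PMF.expect_sum, ← Finset.sum_sub_distrib, Finset.sum_eq_single e]
  · rw [PMF.expect_const_mul]
    simp only [indicatorProp_mul_self, I.prob_mem (hs he)]
    nlinarith [sq_nonneg (b e * I.p e)]
  · intro f hf hfe
    rw [PMF.expect_const_mul, I.prob_mem_mem (hs he) (hs hf) hfe.symm]
    ring
  · exact fun h => absurd he h

/-- The recursive drawing is the union over an independent family, which gives access to the
individual samples. -/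
theorem selectQueries_expect (I : StochGraph V) (μ : Finset (Sym2 V) → Finset (Sym2 V)) (t : ℕ)
    (F : Finset (Sym2 V) → ℝ) :
    (I.selectQueries μ t).expect F =
      (I.realization.iid t).expect fun ω => F (Finset.univ.biUnion fun i => μ (ω i)) := by
  induction t generalizing F with
  | zero =>
    rw [selectQueries, PMF.expect_pure, ← (I.realization.iid 0).expect_const (F ∅)]
    rfl
  | succ t ih =>
    rw [selectQueries, PMF.expect_bind, PMF.expect_iid_succ _ 0, ih, PMF.expect_comm]
    congr 1
    funext ω
    rw [PMF.expect_map]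
    congr 1
    funext S
    congr 1
    ext e
    simp only [Finset.mem_union, Finset.mem_biUnion, Finset.mem_univ, true_and,
      Fin.insertNth_zero', Fin.exists_fin_succ, Fin.cons_zero, Fin.cons_succ]
    tauto

theorem selectQueries_support (I : StochGraph V) {μ : Finset (Sym2 V) → Finset (Sym2 V)}
    (hμ : I.IsMaxMatchingRule μ) (t : ℕ) :
    ∀ Q ∈ (I.selectQueries μ t).support, Q ⊆ I.edges ∧ ∀ v, edgeDegree Q v ≤ t := by
  classical
  induction t with
  | zero =>
    intro Q hQ
    rw [selectQueries, PMF.support_pure, Set.mem_singleton_iff] at hQ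
    subst hQ
    simp [edgeDegree]
  | succ t ih =>
    intro Q hQ
    rw [selectQueries, PMF.mem_support_bind_iff] at hQ
    obtain ⟨Q', hQ', hQ⟩ := hQ
    rw [PMF.mem_support_map_iff] at hQ
    obtain ⟨S, hS, rfl⟩ := hQ
    have hm := (hμ S (I.subset_of_mem_support hS)).1
    refine ⟨Finset.union_subset (ih Q' hQ').1 (hm.1.trans (I.subset_of_mem_support hS)), fun v => ?_⟩
    have h1 := (ih Q' hQ').2 v
    have h2 : ((μ S).filter fun e => v ∈ e).card ≤ 1 := by
      rw [Finset.card_le_one]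
      intro a ha b hb
      rw [Finset.mem_filter] at ha hb
      exact hm.2 a ha.1 b hb.1 v ha.2 hb.2
    have h3 := Finset.card_union_le (Q'.filter fun e => v ∈ e) ((μ S).filter fun e => v ∈ e)
    rw [← Finset.filter_union] at h3
    rw [edgeDegree_eq] at h1 ⊢
    omega

end StochGraph

/-! ### Excess, sample averages and vertex loads -/

/-- The amount by which a real number exceeds one. -/
def excess (x : ℝ) : ℝ := max (x - 1) 0

theorem excess_nonneg (x : ℝ) : 0 ≤ excess x := le_max_right _ _

theorem excess_mono : Monotone excess := fun _ _ h => max_le_max (sub_le_sub_right h 1) le_rfl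

theorem excess_add_le (x y : ℝ) (hy : 0 ≤ y) : excess (x + y) ≤ excess x + y := by
  unfold excess
  refine max_le ?_ (add_nonneg (le_max_right _ _) hy)
  have := le_max_left (x - 1) 0
  linarith

theorem excess_le_add_abs (x y : ℝ) : excess x ≤ excess y + |x - y| := by
  refine le_trans (excess_mono ?_) (excess_add_le y |x - y| (abs_nonneg _))
  have := le_abs_self (x - y)
  linarith

/-- Between 1 and 2 the product is x(2 − x) = 1 − (x − 1)². Hence damping by 1 minus the excess
repairs an overloaded vertex without any division. -/
theorem mul_max_one_sub_excess_le (x : ℝ) : x * max 0 (1 - excess x) ≤ 1 := by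
  unfold excess
  rcases le_total x 1 with h | h
  · rw [max_eq_right (by linarith : x - 1 ≤ 0), sub_zero, max_eq_right zero_le_one]
    linarith
  · rw [max_eq_left (by linarith : 0 ≤ x - 1)]
    rcases le_total (1 - (x - 1)) 0 with h' | h'
    · rw [max_eq_left h']; linarith
    · rw [max_eq_right h']; nlinarith [sq_nonneg (x - 1)]

section SampleMean

variable {Ω : Type*}

theorem sampleMean_nonneg {t : ℕ} {g : Ω → ℝ} (hg : ∀ ω, 0 ≤ g ω) (D : Fin t → Ω) :
    0 ≤ sampleMean g D :=
  div_nonneg (Finset.sum_nonneg fun _ _ => hg _) (Nat.cast_nonneg t)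

theorem sampleMean_mono {t : ℕ} {f g : Ω → ℝ} (h : ∀ ω, f ω ≤ g ω) (D : Fin t → Ω) :
    sampleMean f D ≤ sampleMean g D :=
  div_le_div_of_nonneg_right (Finset.sum_le_sum fun _ _ => h _) (Nat.cast_nonneg t)

theorem sampleMean_add {t : ℕ} (f g : Ω → ℝ) (D : Fin t → Ω) :
    sampleMean (fun ω => f ω + g ω) D = sampleMean f D + sampleMean g D := by
  simp only [sampleMean, Finset.sum_add_distrib, add_div]

theorem sampleMean_mul_const {t : ℕ} (f : Ω → ℝ) (c : ℝ) (D : Fin t → Ω) :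
    sampleMean (fun ω => f ω * c) D = sampleMean f D * c := by
  simp only [sampleMean, ← Finset.sum_mul]
  ring

theorem sampleMean_sum {t : ℕ} {ι : Type*} (s : Finset ι) (f : ι → Ω → ℝ) (D : Fin t → Ω) :
    sampleMean (fun ω => ∑ i ∈ s, f i ω) D = ∑ i ∈ s, sampleMean (f i) D := by
  simp only [sampleMean, ← Finset.sum_div]
  rw [Finset.sum_comm]

end SampleMean

section Sampling

variable {V : Type u} [Fintype V] [DecidableEq V] {Ω Ω' : Type*} [Fintype Ω] [Fintype Ω']

/-- The probability that the edge `e` belongs to the random edge set `m`. -/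
noncomputable def edgeProb (d : PMF Ω) (m : Ω → Finset (Sym2 V)) (e : Sym2 V) : ℝ :=
  d.expect fun ω => indicatorProp (e ∈ m ω)

/-- The probability that both endpoints of `e` belong to the random vertex set `A`. -/
noncomputable def freeProb (R : PMF Ω') (A : Ω' → Finset V) (e : Sym2 V) : ℝ :=
  R.expect fun ω => indicatorProp (∀ v ∈ e, v ∈ A ω)

/-- The factor by which a sample of the edge `e` contributes to the load of its endpoint `v`. -/
noncomputable def loadFactor (J : StochGraph V) (P : Sym2 V → ℝ) (T : Finset (Sym2 V))
    (a : Finset V) (v : V) (e : Sym2 V) : ℝ :=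
  indicatorProp (∀ u ∈ e, u ≠ v → u ∈ a) * (indicatorProp (e ∈ T) / (J.p e * P e))

/-- The contribution of one sample to the load of `v`. -/
noncomputable def sampleLoad (J : StochGraph V) (P : Sym2 V → ℝ) (m : Ω → Finset (Sym2 V))
    (T : Finset (Sym2 V)) (a : Finset V) (v : V) (ω : Ω) : ℝ :=
  ∑ e ∈ J.edges with v ∈ e, indicatorProp (e ∈ m ω) * loadFactor J P T a v e

/-- The factor by which a sample of `e` contributes to the value given to `e`. -/
noncomputable def edgeFactor (J : StochGraph V) (P : Sym2 V → ℝ) (T : Finset (Sym2 V))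
    (a : Finset V) (e : Sym2 V) : ℝ :=
  indicatorProp (∀ u ∈ e, u ∈ a) * (indicatorProp (e ∈ T) / (J.p e * P e))

/-- The value given to `e` before truncation. -/
noncomputable def rawValue (J : StochGraph V) (P : Sym2 V → ℝ) (m : Ω → Finset (Sym2 V)) {t : ℕ}
    (D : Fin t → Ω) (T : Finset (Sym2 V)) (a : Finset V) (e : Sym2 V) : ℝ :=
  sampleMean (fun ω => indicatorProp (e ∈ m ω)) D * edgeFactor J P T a e

/-- The expected load of `v` given the set `a` of free vertices. -/
noncomputable def expectedLoad (J : StochGraph V) (P q : Sym2 V → ℝ) (a : Finset V) (v : V) : ℝ :=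
  ∑ e ∈ J.edges with v ∈ e, q e / P e * indicatorProp (∀ u ∈ e, u ≠ v → u ∈ a)

/-- The edges of `J` are rarely in the random matching `m`, compared to the lower bound `ρ` on
their realization probabilities, and both their endpoints often lie in `A`. -/
structure IsSparseSampling (d : PMF Ω) (m : Ω → Finset (Sym2 V)) (J : StochGraph V)
    (R : PMF Ω') (A : Ω' → Finset V) (δ τ ρ : ℝ) : Prop where
  matching : ∀ ω, IsMatchingIn Finset.univ (m ω)
  δ_pos : 0 < δ
  τ_nonneg : 0 ≤ τ
  ρ_pos : 0 < ρ
  ρ_le : ∀ e ∈ J.edges, ρ ≤ J.p e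
  le_freeProb : ∀ e ∈ J.edges, δ ≤ freeProb R A e
  edgeProb_le : ∀ e ∈ J.edges, edgeProb d m e ≤ τ * ρ
  degree_le : ∀ v, ∑ e ∈ J.edges with v ∈ e, edgeProb d m e ≤ R.prob fun ω => v ∈ A ω
  variance_le : ∀ v, R.variance
    (fun ω => expectedLoad J (freeProb R A) (edgeProb d m) (A ω) v) ≤ 6 * τ / δ ^ 2

theorem edgeProb_nonneg {V : Type*} (d : PMF Ω) (m : Ω → Finset (Sym2 V)) (e : Sym2 V) :
    0 ≤ edgeProb d m e :=
  d.expect_nonneg fun _ => indicatorProp_nonneg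

theorem expect_sampleLoad (d : PMF Ω) (m : Ω → Finset (Sym2 V)) (J : StochGraph V) (R : PMF Ω')
    (A : Ω' → Finset V) (T : Finset (Sym2 V)) (a : Finset V) (v : V) :
    d.expect (sampleLoad J (freeProb R A) m T a v) =
      ∑ e ∈ J.edges with v ∈ e, edgeProb d m e * loadFactor J (freeProb R A) T a v e := by
  unfold sampleLoad
  rw [PMF.expect_sum]
  exact Finset.sum_congr rfl fun e _ => PMF.expect_mul_const _ _ _

theorem expect_sampleLoad_eq_sum (d : PMF Ω) (m : Ω → Finset (Sym2 V)) (J : StochGraph V)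
    (R : PMF Ω') (A : Ω' → Finset V) (T : Finset (Sym2 V)) (a : Finset V) (v : V) :
    d.expect (sampleLoad J (freeProb R A) m T a v) = ∑ e ∈ J.edges with v ∈ e,
      edgeProb d m e * indicatorProp (∀ u ∈ e, u ≠ v → u ∈ a) / (J.p e * freeProb R A e) *
        indicatorProp (e ∈ T) := by
  rw [expect_sampleLoad]
  refine Finset.sum_congr rfl fun e _ => ?_
  rw [loadFactor]
  ring

namespace IsSparseSampling

variable {d : PMF Ω} {m : Ω → Finset (Sym2 V)} {J : StochGraph V} {R : PMF Ω'}
  {A : Ω' → Finset V} {δ τ ρ : ℝ}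

section

variable (h : IsSparseSampling d m J R A δ τ ρ)

include h

theorem p_pos {e : Sym2 V} (he : e ∈ J.edges) : 0 < J.p e := h.ρ_pos.trans_le (h.ρ_le e he)

theorem freeProb_pos {e : Sym2 V} (he : e ∈ J.edges) : 0 < freeProb R A e :=
  h.δ_pos.trans_le (h.le_freeProb e he)

theorem loadFactor_nonneg (T : Finset (Sym2 V)) (a : Finset V) (v : V) {e : Sym2 V}
    (he : e ∈ J.edges) : 0 ≤ loadFactor J (freeProb R A) T a v e :=
  mul_nonneg indicatorProp_nonneg
    (div_nonneg indicatorProp_nonneg (mul_pos (h.p_pos he) (h.freeProb_pos he)).le)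

theorem inv_le {e : Sym2 V} (he : e ∈ J.edges) :
    1 / (J.p e * freeProb R A e) ≤ 1 / (ρ * δ) :=
  one_div_le_one_div_of_le (mul_pos h.ρ_pos h.δ_pos)
    (mul_le_mul (h.ρ_le e he) (h.le_freeProb e he) h.δ_pos.le (h.p_pos he).le)

theorem loadFactor_le (T : Finset (Sym2 V)) (a : Finset V) (v : V) {e : Sym2 V}
    (he : e ∈ J.edges) : loadFactor J (freeProb R A) T a v e ≤ 1 / (ρ * δ) := by
  refine le_trans ?_ (h.inv_le he)
  have hpos := mul_pos (h.p_pos he) (h.freeProb_pos he)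
  calc _ ≤ 1 * (indicatorProp (e ∈ T) / (J.p e * freeProb R A e)) :=
        mul_le_mul_of_nonneg_right indicatorProp_le_one (div_nonneg indicatorProp_nonneg hpos.le)
    _ ≤ _ := by
        rw [one_mul]
        exact div_le_div_of_nonneg_right indicatorProp_le_one hpos.le

theorem edgeFactor_nonneg (T : Finset (Sym2 V)) (a : Finset V) {e : Sym2 V}
    (he : e ∈ J.edges) : 0 ≤ edgeFactor J (freeProb R A) T a e :=
  mul_nonneg indicatorProp_nonneg
    (div_nonneg indicatorProp_nonneg (mul_pos (h.p_pos he) (h.freeProb_pos he)).le)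

theorem edgeFactor_le_loadFactor (T : Finset (Sym2 V)) (a : Finset V) (v : V) {e : Sym2 V}
    (he : e ∈ J.edges) :
    edgeFactor J (freeProb R A) T a e ≤ loadFactor J (freeProb R A) T a v e :=
  mul_le_mul_of_nonneg_right (indicatorProp_mono fun hu u hue _ => hu u hue)
    (div_nonneg indicatorProp_nonneg (mul_pos (h.p_pos he) (h.freeProb_pos he)).le)

theorem sampleLoad_nonneg (T : Finset (Sym2 V)) (a : Finset V) (v : V) (ω : Ω) :
    0 ≤ sampleLoad J (freeProb R A) m T a v ω :=
  Finset.sum_nonneg fun _ he => mul_nonneg indicatorProp_nonneg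
    (h.loadFactor_nonneg T a v (Finset.mem_filter.1 he).1)

/-- If `e` is sampled, it is the only edge that contributes to the load of its endpoint `v`. -/
theorem sampleLoad_eq (T : Finset (Sym2 V)) (a : Finset V) {v : V} {e : Sym2 V}
    (he : e ∈ J.edges) (hv : v ∈ e) {ω : Ω} (hω : e ∈ m ω) :
    sampleLoad J (freeProb R A) m T a v ω = loadFactor J (freeProb R A) T a v e := by
  rw [sampleLoad, Finset.sum_eq_single e]
  · rw [indicatorProp_true hω, one_mul]
  · intro f hf hfe
    rw [indicatorProp_false, zero_mul]
    exact fun hfm => hfe ((h.matching ω).2 f hfm e hω v (Finset.mem_filter.1 hf).2 hv)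
  · exact fun hne => absurd (Finset.mem_filter.2 ⟨he, hv⟩) hne

theorem sampleLoad_le (T : Finset (Sym2 V)) (a : Finset V) (v : V) (ω : Ω) :
    sampleLoad J (freeProb R A) m T a v ω ≤ 1 / (ρ * δ) := by
  by_cases hex : ∃ e ∈ J.edges, v ∈ e ∧ e ∈ m ω
  · obtain ⟨e, he, hv, hω⟩ := hex
    rw [h.sampleLoad_eq T a he hv hω]
    exact h.loadFactor_le T a v he
  · push Not at hex
    rw [sampleLoad, Finset.sum_eq_zero]
    · exact (one_div_pos.2 (mul_pos h.ρ_pos h.δ_pos)).le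
    · intro e he
      rw [Finset.mem_filter] at he
      rw [indicatorProp_false (hex e he.1 he.2), zero_mul]

/-- The factor p_e in the denominator is cancelled by the realization of e. As the load ignores
whether `v` is free, what remains has the form of Z_v. -/
theorem expect_expect_sampleLoad (a : Finset V) (v : V) :
    J.realization.expect (fun T => d.expect (sampleLoad J (freeProb R A) m T a v)) =
      expectedLoad J (freeProb R A) (edgeProb d m) a v := by
  simp only [expect_sampleLoad_eq_sum]
  rw [J.expect_sum_mem (Finset.filter_subset _ _), expectedLoad]
  refine Finset.sum_congr rfl fun e he => ?_
  have h1 := h.p_pos (Finset.mem_filter.1 he).1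
  have h2 := h.freeProb_pos (Finset.mem_filter.1 he).1
  field_simp

theorem sum_edgeProb_le_one (v : V) : ∑ e ∈ J.edges with v ∈ e, edgeProb d m e ≤ 1 :=
  (h.degree_le v).trans (R.prob_le_one _)

theorem expectedLoad_le (a : Finset V) (v : V) :
    expectedLoad J (freeProb R A) (edgeProb d m) a v ≤ 1 / δ := by
  calc expectedLoad J (freeProb R A) (edgeProb d m) a v
      ≤ ∑ e ∈ J.edges with v ∈ e, edgeProb d m e * (1 / δ) := by
        refine Finset.sum_le_sum fun e he => ?_
        have he' := (Finset.mem_filter.1 he).1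
        have hq := edgeProb_nonneg d m e
        calc edgeProb d m e / freeProb R A e * _ ≤ edgeProb d m e / freeProb R A e * 1 :=
              mul_le_mul_of_nonneg_left indicatorProp_le_one
                (div_nonneg hq (h.freeProb_pos he').le)
          _ = edgeProb d m e * (1 / freeProb R A e) := by ring
          _ ≤ _ := mul_le_mul_of_nonneg_left
              (one_div_le_one_div_of_le h.δ_pos (h.le_freeProb e he')) hq
    _ = (∑ e ∈ J.edges with v ∈ e, edgeProb d m e) * (1 / δ) := by rw [Finset.sum_mul]
    _ ≤ 1 * (1 / δ) := mul_le_mul_of_nonneg_right (h.sum_edgeProb_le_one v)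
        (one_div_pos.2 h.δ_pos).le
    _ = 1 / δ := one_mul _

/-- Each edge contributes at most q_e · (q_e / p_e) / Pr[e ⊆ A]². Here q_e / p_e ≤ τ, and the q_e at
`v` sum to at most 1. -/
theorem variance_expect_sampleLoad_le (a : Finset V) (v : V) :
    J.realization.variance (fun T => d.expect (sampleLoad J (freeProb R A) m T a v)) ≤
      τ / δ ^ 2 := by
  simp only [expect_sampleLoad_eq_sum]
  refine (J.variance_sum_mem_le (Finset.filter_subset _ _) _).trans ?_
  have hδ := h.δ_pos
  calc _ ≤ ∑ e ∈ J.edges with v ∈ e, edgeProb d m e * (τ / δ ^ 2) := by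
        refine Finset.sum_le_sum fun e he => ?_
        have he' := (Finset.mem_filter.1 he).1
        have hq := edgeProb_nonneg d m e
        have hp := h.p_pos he'
        have hP := h.freeProb_pos he'
        have hi : indicatorProp (∀ u ∈ e, u ≠ v → u ∈ a) ^ 2 ≤ 1 :=
          pow_le_one₀ indicatorProp_nonneg indicatorProp_le_one
        have hqp : edgeProb d m e / J.p e ≤ τ := by
          rw [div_le_iff₀ hp]
          exact (h.edgeProb_le e he').trans (mul_le_mul_of_nonneg_left (h.ρ_le e he') h.τ_nonneg)
        have hP2 : 1 / freeProb R A e ^ 2 ≤ 1 / δ ^ 2 :=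
          one_div_le_one_div_of_le (by positivity)
            (pow_le_pow_left₀ hδ.le (h.le_freeProb e he') 2)
        calc _ = edgeProb d m e * ((edgeProb d m e / J.p e) * (1 / freeProb R A e ^ 2) *
              indicatorProp (∀ u ∈ e, u ≠ v → u ∈ a) ^ 2) := by field_simp
          _ ≤ edgeProb d m e * (τ * (1 / δ ^ 2) * 1) := by
              refine mul_le_mul_of_nonneg_left ?_ hq
              refine mul_le_mul (mul_le_mul hqp hP2 (by positivity) h.τ_nonneg) hi
                (sq_nonneg _) (mul_nonneg h.τ_nonneg (by positivity))
          _ = _ := by ring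
    _ = (∑ e ∈ J.edges with v ∈ e, edgeProb d m e) * (τ / δ ^ 2) := by rw [Finset.sum_mul]
    _ ≤ 1 * (τ / δ ^ 2) := mul_le_mul_of_nonneg_right (h.sum_edgeProb_le_one v)
        (div_nonneg h.τ_nonneg (sq_nonneg δ))
    _ = τ / δ ^ 2 := one_mul _

/-- The mean load of `v` is bounded since the load hardly depends on whether `v` is free. -/
theorem excess_mean_le {θ : ℝ} (hθ : 0 < θ) (v : V) :
    excess (R.expect fun ω => expectedLoad J (freeProb R A) (edgeProb d m) (A ω) v) ≤
      (θ + 6 * τ / δ ^ 2 / θ) / δ := by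
  have hδ := h.δ_pos
  have hτ := h.τ_nonneg
  have hrhs : 0 ≤ (θ + 6 * τ / δ ^ 2 / θ) / δ := by positivity
  set Z : Ω' → ℝ := fun ω => expectedLoad J (freeProb R A) (edgeProb d m) (A ω) v with hZ
  set M := R.expect Z with hM
  by_cases hex : ∃ e ∈ J.edges, v ∈ e
  · obtain ⟨e, he, hv⟩ := hex
    have hprob : δ ≤ R.prob fun ω => v ∈ A ω :=
      (h.le_freeProb e he).trans (R.expect_mono fun ω => indicatorProp_mono fun hu => hu v hv)
    -- Requiring `v` to be free as well completes the event that both endpoints are free, whose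
    -- probability is the denominator.
    have h1 : R.expect (fun ω => indicatorProp (v ∈ A ω) * Z ω) =
        ∑ e ∈ J.edges with v ∈ e, edgeProb d m e := by
      simp only [hZ, expectedLoad, Finset.mul_sum]
      rw [PMF.expect_sum]
      refine Finset.sum_congr rfl fun f hf => ?_
      rw [Finset.mem_filter] at hf
      have hP := (h.freeProb_pos hf.1).ne'
      calc _ = R.expect (fun ω => edgeProb d m f / freeProb R A f *
            indicatorProp (∀ u ∈ f, u ∈ A ω)) := by
            congr 1
            funext ω
            by_cases hvA : v ∈ A ω
            · rw [indicatorProp_true hvA, one_mul]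
              congr 2
              refine propext ⟨fun hu u huf => ?_, fun hu u huf _ => hu u huf⟩
              by_cases huv : u = v
              · rwa [huv]
              · exact hu u huf huv
            · rw [indicatorProp_false hvA, zero_mul,
                indicatorProp_false fun hu => hvA (hu v hf.2), mul_zero]
        _ = edgeProb d m f / freeProb R A f * freeProb R A f := PMF.expect_const_mul _ _ _
        _ = edgeProb d m f := div_mul_cancel₀ _ hP
    -- The left side is a negated covariance, bounded by the mean absolute deviation of `Z`. With
    -- `h1` and `degree_le` it gives (M − 1) Pr[v ∈ A] ≤ error, and Pr[v ∈ A] ≥ δ.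
    have h2 : M * R.prob (fun ω => v ∈ A ω) - R.expect (fun ω => indicatorProp (v ∈ A ω) * Z ω) ≤
        θ + 6 * τ / δ ^ 2 / θ := by
      rw [PMF.prob_eq_expect, ← PMF.expect_const_mul, ← PMF.expect_sub]
      have h3 := R.expect_abs_sub_le Z hθ
      have h4 := div_le_div_of_nonneg_right (h.variance_le v) hθ.le
      refine le_trans (R.expect_mono fun ω => ?_) (h3.trans (add_le_add le_rfl h4))
      rw [← hM]
      have : M * indicatorProp (v ∈ A ω) - indicatorProp (v ∈ A ω) * Z ω =
        indicatorProp (v ∈ A ω) * (M - Z ω) := by ring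
      rw [this]
      calc _ ≤ indicatorProp (v ∈ A ω) * |Z ω - M| := by
            refine mul_le_mul_of_nonneg_left ?_ indicatorProp_nonneg
            rw [abs_sub_comm]; exact le_abs_self _
        _ ≤ 1 * |Z ω - M| := mul_le_mul_of_nonneg_right indicatorProp_le_one (abs_nonneg _)
        _ = _ := one_mul _
    have h5 := h.degree_le v
    rw [h1] at h2
    refine max_le ?_ hrhs
    rw [le_div_iff₀ hδ]
    rcases le_total M 1 with hM1 | hM1
    · have : 0 ≤ θ + 6 * τ / δ ^ 2 / θ := by positivity
      nlinarith
    · nlinarith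
  · push Not at hex
    have hZ0 : Z = fun _ => 0 := by
      funext ω
      simp only [hZ, expectedLoad]
      rw [Finset.filter_false_of_mem hex, Finset.sum_empty]
    rw [hM, hZ0, PMF.expect_const]
    refine max_le ?_ hrhs
    linarith

end

end IsSparseSampling

end Sampling

/-! ### Truncated edge values and their expectation -/

section Sampling

variable {V : Type u} [Fintype V] [DecidableEq V] {Ω Ω' : Type*} [Fintype Ω] [Fintype Ω']

/-- The value given to the edge `e`. -/
noncomputable def edgeValue (J : StochGraph V) (P : Sym2 V → ℝ) (m : Ω → Finset (Sym2 V)) (η : ℝ)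
    {t : ℕ} (D : Fin t → Ω) (T : Finset (Sym2 V)) (a : Finset V) (e : Sym2 V) : ℝ :=
  rawValue J P m D T a e * max 0 (1 - ∑ v with v ∈ e, excess (sampleMean (sampleLoad J P m T a v) D)
    - rawValue J P m D T a e / η)

theorem of_edgeValue_ne_zero {Ω : Type*} {m : Ω → Finset (Sym2 V)} {J : StochGraph V} {t : ℕ}
    {P : Sym2 V → ℝ} {η : ℝ} {D : Fin t → Ω} {T : Finset (Sym2 V)}
    {a : Finset V} {e : Sym2 V} (hne : edgeValue J P m η D T a e ≠ 0) :
    (∃ i, e ∈ m (D i)) ∧ e ∈ T ∧ ∀ v ∈ e, v ∈ a := by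
  have h1 := left_ne_zero_of_mul hne
  have h2 := left_ne_zero_of_mul h1
  have h3 := right_ne_zero_of_mul h1
  refine ⟨?_, ?_, ?_⟩
  · by_contra! hno
    refine h2 ?_
    simp only [sampleMean, indicatorProp_false (hno _), Finset.sum_const_zero, zero_div]
  · by_contra hno
    refine right_ne_zero_of_mul h3 ?_
    rw [indicatorProp_false hno, zero_div]
  · by_contra hno
    exact left_ne_zero_of_mul h3 (indicatorProp_false hno)

namespace IsSparseSampling

variable {d : PMF Ω} {m : Ω → Finset (Sym2 V)} {J : StochGraph V} {R : PMF Ω'}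
  {A : Ω' → Finset V} {δ τ ρ : ℝ}

section

variable (h : IsSparseSampling d m J R A δ τ ρ) {t : ℕ} (ht : t ≠ 0)

include h

theorem rawValue_nonneg (D : Fin t → Ω) (T : Finset (Sym2 V)) (a : Finset V) {e : Sym2 V}
    (he : e ∈ J.edges) : 0 ≤ rawValue J (freeProb R A) m D T a e :=
  mul_nonneg (sampleMean_nonneg (fun _ => indicatorProp_nonneg) D) (h.edgeFactor_nonneg T a he)

theorem sum_rawValue_le (D : Fin t → Ω) (T : Finset (Sym2 V)) (a : Finset V) (v : V) :
    ∑ e ∈ J.edges with v ∈ e, rawValue J (freeProb R A) m D T a e ≤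
      sampleMean (sampleLoad J (freeProb R A) m T a v) D := by
  have : sampleLoad J (freeProb R A) m T a v = fun ω => ∑ e ∈ J.edges with v ∈ e,
    indicatorProp (e ∈ m ω) * loadFactor J (freeProb R A) T a v e := rfl
  rw [this, sampleMean_sum]
  refine Finset.sum_le_sum fun e he => ?_
  rw [sampleMean_mul_const]
  exact mul_le_mul_of_nonneg_left
    (h.edgeFactor_le_loadFactor T a v (Finset.mem_filter.1 he).1)
    (sampleMean_nonneg (fun _ => indicatorProp_nonneg) D)

theorem edgeValue_nonneg (η : ℝ) (D : Fin t → Ω) (T : Finset (Sym2 V)) (a : Finset V) {e : Sym2 V}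
    (he : e ∈ J.edges) : 0 ≤ edgeValue J (freeProb R A) m η D T a e :=
  mul_nonneg (h.rawValue_nonneg D T a he) (le_max_left _ _)

/-- The last term of the damping factor makes the value vanish as soon as the raw value reaches η.
-/
theorem edgeValue_le {η : ℝ} (hη : 0 < η) (D : Fin t → Ω) (T : Finset (Sym2 V)) (a : Finset V)
    {e : Sym2 V} (he : e ∈ J.edges) : edgeValue J (freeProb R A) m η D T a e ≤ η := by
  unfold edgeValue
  have hr := h.rawValue_nonneg D T a he
  set r := rawValue J (freeProb R A) m D T a e
  have hsum : 0 ≤ ∑ v with v ∈ e, excess (sampleMean (sampleLoad J (freeProb R A) m T a v) D) :=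
    Finset.sum_nonneg fun _ _ => excess_nonneg _
  have hle : r * max 0 (1 - ∑ v with v ∈ e,
      excess (sampleMean (sampleLoad J (freeProb R A) m T a v) D) - r / η) ≤
      r * max 0 (1 - r / η) :=
    mul_le_mul_of_nonneg_left (max_le_max le_rfl (by linarith)) hr
  refine hle.trans ?_
  rcases le_total (1 - r / η) 0 with h0 | h0
  · rw [max_eq_left h0, mul_zero]
    exact hη.le
  · rw [max_eq_right h0]
    have h1 : r ≤ η := by
      rw [sub_nonneg, div_le_one hη] at h0
      exact h0
    have h2 : 0 ≤ r / η := by positivity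
    nlinarith

/-- Every edge at `v` is damped at least by the excess load of `v`, and the load of `v` dominates
the sum of its raw values. -/
theorem sum_edgeValue_le {η : ℝ} (hη : 0 < η) (D : Fin t → Ω) (T : Finset (Sym2 V)) (a : Finset V)
    (v : V) : ∑ e ∈ J.edges with v ∈ e, edgeValue J (freeProb R A) m η D T a e ≤ 1 := by
  refine le_trans ?_ (mul_max_one_sub_excess_le
    (sampleMean (sampleLoad J (freeProb R A) m T a v) D))
  refine le_trans ?_ (mul_le_mul_of_nonneg_right (h.sum_rawValue_le D T a v) (le_max_left _ _))
  rw [Finset.sum_mul]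
  refine Finset.sum_le_sum fun e he => ?_
  rw [Finset.mem_filter] at he
  have hr := h.rawValue_nonneg D T a he.1
  refine mul_le_mul_of_nonneg_left (max_le_max le_rfl ?_) hr
  have h1 : excess (sampleMean (sampleLoad J (freeProb R A) m T a v) D) ≤
      ∑ u with u ∈ e, excess (sampleMean (sampleLoad J (freeProb R A) m T a u) D) :=
    Finset.single_le_sum
      (f := fun u => excess (sampleMean (sampleLoad J (freeProb R A) m T a u) D))
      (fun _ _ => excess_nonneg _) (Finset.mem_filter.2 ⟨Finset.mem_univ v, he.2⟩)
  have h2 := div_nonneg hr hη.le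
  linarith

theorem expect_edgeFactor {e : Sym2 V} (he : e ∈ J.edges) :
    R.expect (fun ω => J.realization.expect fun T =>
      edgeFactor J (freeProb R A) T (A ω) e) = 1 := by
  have hp := (h.p_pos he).ne'
  have hP := (h.freeProb_pos he).ne'
  simp only [PMF.expect_mul_const, PMF.expect_const_mul,
    edgeFactor, PMF.expect_div_const, J.prob_mem he]
  rw [← freeProb]
  field_simp

include ht

/-- The load of every vertex rarely exceeds one by much. -/
theorem expect_excess_le {θ : ℝ} (hθ : 0 < θ) (v : V) :
    R.expect (fun ω => J.realization.expect fun T => (d.iid t).expect fun D =>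
      excess (sampleMean (sampleLoad J (freeProb R A) m T (A ω) v) D)) ≤
    (θ + 6 * τ / δ ^ 2 / θ) / δ + (3 * θ + (1 / (ρ * δ) / δ / t + 7 * τ / δ ^ 2) / θ) := by
  have hT : (0 : ℝ) < t := by positivity
  have hδ := h.δ_pos
  have hρ := h.ρ_pos
  set M := R.expect fun ω => expectedLoad J (freeProb R A) (edgeProb d m) (A ω) v with hM
  -- Three sources of randomness are averaged out in turn, each costing one mean absolute deviation:
  -- the samples, then the noncrucial realization, then the set of free vertices. The sampling error
  -- stays proportional to the conditional mean load so that it can be averaged next.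
  have layer1 : ∀ T a, (d.iid t).expect (fun D =>
      excess (sampleMean (sampleLoad J (freeProb R A) m T a v) D)) ≤
      excess M + (θ + 1 / (ρ * δ) / t / θ * d.expect (sampleLoad J (freeProb R A) m T a v)) +
        |d.expect (sampleLoad J (freeProb R A) m T a v) - M| := by
    intro T a
    set g := sampleLoad J (freeProb R A) m T a v with hg
    have h1 := (d.iid t).expect_abs_sub_le (sampleMean g) hθ
    rw [d.expect_sampleMean ht] at h1
    have h2 := d.variance_sampleMean_le ht (g := g) (B := 1 / (ρ * δ))
      (h.sampleLoad_nonneg T a v) (h.sampleLoad_le T a v)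
    have h3 := div_le_div_of_nonneg_right h2 hθ.le
    calc (d.iid t).expect (fun D => excess (sampleMean g D))
        ≤ (d.iid t).expect (fun D => |sampleMean g D - d.expect g| +
            (excess M + |d.expect g - M|)) := by
          refine PMF.expect_mono _ fun D => (excess_le_add_abs _ M).trans ?_
          have := abs_sub_le (sampleMean g D) (d.expect g) M
          linarith
      _ = (d.iid t).expect (fun D => |sampleMean g D - d.expect g|) +
            (excess M + |d.expect g - M|) := by rw [PMF.expect_add, PMF.expect_const]
      _ ≤ _ := by
          have : 1 / (ρ * δ) * d.expect g / t / θ = 1 / (ρ * δ) / t / θ * d.expect g := by ring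
          linarith
  have layer2 : ∀ a, J.realization.expect (fun T => (d.iid t).expect fun D =>
      excess (sampleMean (sampleLoad J (freeProb R A) m T a v) D)) ≤
      excess M + (θ + 1 / (ρ * δ) / t / θ * (1 / δ)) + (θ + τ / δ ^ 2 / θ) +
        |expectedLoad J (freeProb R A) (edgeProb d m) a v - M| := by
    intro a
    set Z := expectedLoad J (freeProb R A) (edgeProb d m) a v with hZ
    set G := fun T => d.expect (sampleLoad J (freeProb R A) m T a v) with hG
    have hGZ : J.realization.expect G = Z := h.expect_expect_sampleLoad a v
    have h1 := J.realization.expect_abs_sub_le G hθ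
    rw [hGZ] at h1
    have h2 := div_le_div_of_nonneg_right (h.variance_expect_sampleLoad_le a v) hθ.le
    have h3 : 1 / (ρ * δ) / t / θ * Z ≤ 1 / (ρ * δ) / t / θ * (1 / δ) :=
      mul_le_mul_of_nonneg_left (h.expectedLoad_le a v) (by positivity)
    calc _ ≤ J.realization.expect (fun T => (1 / (ρ * δ) / t / θ * G T + |G T - Z|) +
            (excess M + θ + |Z - M|)) := by
          refine PMF.expect_mono _ fun T => (layer1 T a).trans ?_
          have := abs_sub_le (G T) Z M
          simp only [hG] at this ⊢
          linarith
      _ = (1 / (ρ * δ) / t / θ * Z + J.realization.expect fun T => |G T - Z|) +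
            (excess M + θ + |Z - M|) := by
          rw [PMF.expect_add, PMF.expect_add, PMF.expect_const, PMF.expect_const_mul, hGZ]
      _ ≤ _ := by linarith
  have h1 := R.expect_abs_sub_le
    (fun ω => expectedLoad J (freeProb R A) (edgeProb d m) (A ω) v) hθ
  rw [← hM] at h1
  have h2 := div_le_div_of_nonneg_right (h.variance_le v) hθ.le
  have h3 := h.excess_mean_le hθ v
  rw [← hM] at h3
  calc _ ≤ R.expect (fun ω => (excess M + (θ + 1 / (ρ * δ) / t / θ * (1 / δ)) +
          (θ + τ / δ ^ 2 / θ)) + |expectedLoad J (freeProb R A) (edgeProb d m) (A ω) v - M|) :=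
        R.expect_mono fun ω => layer2 (A ω)
    _ = (excess M + (θ + 1 / (ρ * δ) / t / θ * (1 / δ)) + (θ + τ / δ ^ 2 / θ)) +
          R.expect fun ω => |expectedLoad J (freeProb R A) (edgeProb d m) (A ω) v - M| := by
        rw [PMF.expect_add, PMF.expect_const]
    _ ≤ (θ + 6 * τ / δ ^ 2 / θ) / δ + (θ + 1 / (ρ * δ) / t / θ * (1 / δ)) +
          (θ + τ / δ ^ 2 / θ) + (θ + 6 * τ / δ ^ 2 / θ) := by linarith
    _ = _ := by ring

theorem expect_rawValue {e : Sym2 V} (he : e ∈ J.edges) :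
    R.expect (fun ω => J.realization.expect fun T => (d.iid t).expect fun D =>
      rawValue J (freeProb R A) m D T (A ω) e) = edgeProb d m e := by
  have hp := (h.p_pos he).ne'
  have hP := (h.freeProb_pos he).ne'
  simp only [rawValue, PMF.expect_mul_const, d.expect_sampleMean ht, PMF.expect_const_mul,
    edgeFactor, PMF.expect_div_const, J.prob_mem he]
  rw [← freeProb, ← edgeProb]
  field_simp

/-- Size biasing applied to the raw value itself: given that `e` is sampled once, its raw value
exceeds the usual mean by at most 1/(ρδt), and that mean is at most τ/δ because q_e ≤ τρ. -/
theorem expect_rawValue_sq_le {e : Sym2 V} (he : e ∈ J.edges) :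
    R.expect (fun ω => J.realization.expect fun T => (d.iid t).expect fun D =>
      rawValue J (freeProb R A) m D T (A ω) e ^ 2) ≤
      edgeProb d m e * (1 / (ρ * δ) / t + τ / δ) := by
  have hδ := h.δ_pos
  have hρ := h.ρ_pos
  obtain ⟨v, hv⟩ : ∃ v, v ∈ e := ⟨_, e.out_fst_mem⟩
  have hq := edgeProb_nonneg d m e
  have key : ∀ T a, (d.iid t).expect (fun D => rawValue J (freeProb R A) m D T a e ^ 2) ≤
      edgeProb d m e * (1 / (ρ * δ) / t + τ / δ) * edgeFactor J (freeProb R A) T a e := by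
    intro T a
    have hk := h.edgeFactor_nonneg T a he
    have hkle := (h.edgeFactor_le_loadFactor T a v he).trans (h.loadFactor_le T a v he)
    set κ := edgeFactor J (freeProb R A) T a e with hκ
    have h1 := d.expect_sampleMean_mul_le ht (a := fun ω => indicatorProp (e ∈ m ω))
      (g := fun ω => indicatorProp (e ∈ m ω) * κ) (c := 1 / (ρ * δ)) (h := fun x => x)
      (fun _ => indicatorProp_nonneg) (fun _ => mul_nonneg indicatorProp_nonneg hk)
      (fun ω _ => (mul_le_mul_of_nonneg_right indicatorProp_le_one hk).trans (by
        rw [one_mul]; exact hkle)) monotone_id (fun x y _ => le_rfl)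
    rw [← edgeProb, d.expect_sampleMean ht, PMF.expect_mul_const, ← edgeProb] at h1
    have h2 : edgeProb d m e * κ ≤ τ / δ := by
      calc edgeProb d m e * κ ≤ (τ * ρ) * (1 / (ρ * δ)) :=
            mul_le_mul (h.edgeProb_le e he) hkle hk (mul_nonneg h.τ_nonneg hρ.le)
        _ = τ / δ := by field_simp
    calc _ = (d.iid t).expect (fun D => sampleMean (fun ω => indicatorProp (e ∈ m ω)) D *
          sampleMean (fun ω => indicatorProp (e ∈ m ω) * κ) D * κ) := by
          congr 1
          funext D
          rw [rawValue, sampleMean_mul_const]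
          ring
      _ ≤ edgeProb d m e * (1 / (ρ * δ) / t + edgeProb d m e * κ) * κ := by
          rw [PMF.expect_mul_const]
          exact mul_le_mul_of_nonneg_right h1 hk
      _ ≤ _ := by gcongr
  calc _ ≤ R.expect (fun ω => J.realization.expect fun T =>
        edgeProb d m e * (1 / (ρ * δ) / t + τ / δ) * edgeFactor J (freeProb R A) T (A ω) e) :=
        R.expect_mono fun ω => J.realization.expect_mono fun T => key T (A ω)
    _ = _ := by
        simp only [PMF.expect_const_mul]
        rw [h.expect_edgeFactor he, mul_one]

/-- The raw value reweights by three events: `e` is sampled, realized, and has free endpoints. The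
first two change the expected excess by 1/(ρδt) and τ/δ only; the third has probability at least δ
and is dropped at the price of the factor 1/δ. -/
theorem expect_rawValue_mul_excess_le {e : Sym2 V} (he : e ∈ J.edges) {v : V} (hv : v ∈ e) :
    R.expect (fun ω => J.realization.expect fun T => (d.iid t).expect fun D =>
      rawValue J (freeProb R A) m D T (A ω) e *
        excess (sampleMean (sampleLoad J (freeProb R A) m T (A ω) v) D)) ≤
      edgeProb d m e / δ * (1 / (ρ * δ) / t + τ / δ +
        R.expect (fun ω => J.realization.expect fun T => (d.iid t).expect fun D =>
          excess (sampleMean (sampleLoad J (freeProb R A) m T (A ω) v) D))) := by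
  have hδ := h.δ_pos
  have hρ := h.ρ_pos
  have hT : (0 : ℝ) < t := by positivity
  have hq := edgeProb_nonneg d m e
  have hp := h.p_pos he
  have hP := h.freeProb_pos he
  set E : Finset (Sym2 V) → Finset V → ℝ := fun T a => (d.iid t).expect fun D =>
    excess (sampleMean (sampleLoad J (freeProb R A) m T a v) D) with hE
  have hE0 : ∀ T a, 0 ≤ E T a := fun T a => PMF.expect_nonneg _ fun _ => excess_nonneg _
  have iid_bound : ∀ T a, (d.iid t).expect (fun D => rawValue J (freeProb R A) m D T a e *
      excess (sampleMean (sampleLoad J (freeProb R A) m T a v) D)) ≤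
      edgeProb d m e * edgeFactor J (freeProb R A) T a e * (1 / (ρ * δ) / t + E T a) := by
    intro T a
    have h1 := d.expect_sampleMean_mul_le ht (a := fun ω => indicatorProp (e ∈ m ω))
      (g := sampleLoad J (freeProb R A) m T a v) (c := 1 / (ρ * δ)) (h := excess)
      (fun _ => indicatorProp_nonneg) (h.sampleLoad_nonneg T a v)
      (fun ω _ => h.sampleLoad_le T a v ω) excess_mono excess_add_le
    have hk := h.edgeFactor_nonneg T a he
    rw [← edgeProb] at h1
    calc _ = (d.iid t).expect (fun D => edgeFactor J (freeProb R A) T a e *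
          (sampleMean (fun ω => indicatorProp (e ∈ m ω)) D *
          excess (sampleMean (sampleLoad J (freeProb R A) m T a v) D))) := by
          congr 1
          funext D
          rw [rawValue]
          ring
      _ ≤ edgeFactor J (freeProb R A) T a e *
          (edgeProb d m e * (1 / (ρ * δ) / t + E T a)) := by
          rw [PMF.expect_const_mul]
          exact mul_le_mul_of_nonneg_left h1 hk
      _ = _ := by ring
  have factor_mono : ∀ (T : Finset (Sym2 V)) a f, f ∈ J.edges →
      loadFactor J (freeProb R A) (T.erase e) a v f ≤ loadFactor J (freeProb R A) T a v f := by
    intro T a f hf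
    refine mul_le_mul_of_nonneg_left ?_ indicatorProp_nonneg
    exact div_le_div_of_nonneg_right (indicatorProp_mono Finset.mem_of_mem_erase)
      (mul_pos (h.p_pos hf) (h.freeProb_pos hf)).le
  have load_mono : ∀ (T : Finset (Sym2 V)) a ω, sampleLoad J (freeProb R A) m (T.erase e) a v ω ≤
      sampleLoad J (freeProb R A) m T a v ω := fun T a ω =>
    Finset.sum_le_sum fun f hf => mul_le_mul_of_nonneg_left
      (factor_mono T a f (Finset.mem_filter.1 hf).1) indicatorProp_nonneg
  have load_le : ∀ (T : Finset (Sym2 V)) a ω, sampleLoad J (freeProb R A) m T a v ω ≤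
      sampleLoad J (freeProb R A) m (T.erase e) a v ω +
        indicatorProp (e ∈ m ω) * (1 / (ρ * δ)) := by
    intro T a ω
    have hmem : e ∈ J.edges.filter fun f => v ∈ f := Finset.mem_filter.2 ⟨he, hv⟩
    unfold sampleLoad
    rw [← Finset.add_sum_erase _ _ hmem, ← Finset.add_sum_erase _
      (fun f => indicatorProp (f ∈ m ω) * loadFactor J (freeProb R A) (T.erase e) a v f) hmem]
    have h1 : ∑ f ∈ (J.edges.filter fun f => v ∈ f).erase e,
        indicatorProp (f ∈ m ω) * loadFactor J (freeProb R A) T a v f =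
        ∑ f ∈ (J.edges.filter fun f => v ∈ f).erase e,
        indicatorProp (f ∈ m ω) * loadFactor J (freeProb R A) (T.erase e) a v f := by
      refine Finset.sum_congr rfl fun f hf => ?_
      have hfe := Finset.ne_of_mem_erase hf
      simp only [loadFactor, Finset.mem_erase, hfe, ne_eq, not_false_eq_true, true_and]
    rw [h1]
    have h2 : 0 ≤ indicatorProp (e ∈ m ω) * loadFactor J (freeProb R A) (T.erase e) a v e :=
      mul_nonneg indicatorProp_nonneg (h.loadFactor_nonneg _ a v he)
    have h3 : indicatorProp (e ∈ m ω) * loadFactor J (freeProb R A) T a v e ≤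
        indicatorProp (e ∈ m ω) * (1 / (ρ * δ)) :=
      mul_le_mul_of_nonneg_left (h.loadFactor_le T a v he) indicatorProp_nonneg
    linarith
  have E_mono : ∀ (T : Finset (Sym2 V)) a, E (T.erase e) a ≤ E T a := fun T a =>
    PMF.expect_mono _ fun D => excess_mono (sampleMean_mono (load_mono T a) D)
  -- Realizing `e` can add to the load only through samples containing `e`, which are rare: on
  -- average at most q_e / (ρδ) ≤ τ/δ.
  have E_le : ∀ (T : Finset (Sym2 V)) a, E T a ≤ E (T.erase e) a + τ / δ := by
    intro T a
    calc E T a ≤ (d.iid t).expect (fun D =>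
          excess (sampleMean (sampleLoad J (freeProb R A) m (T.erase e) a v) D) +
          sampleMean (fun ω => indicatorProp (e ∈ m ω)) D * (1 / (ρ * δ))) := by
          refine PMF.expect_mono _ fun D => ?_
          refine (excess_mono (sampleMean_mono (load_le T a) D)).trans ?_
          rw [sampleMean_add, sampleMean_mul_const]
          exact excess_add_le _ _ (mul_nonneg
            (sampleMean_nonneg (fun _ => indicatorProp_nonneg) D) (by positivity))
      _ = E (T.erase e) a + edgeProb d m e * (1 / (ρ * δ)) := by
          rw [PMF.expect_add, PMF.expect_mul_const, d.expect_sampleMean ht, ← edgeProb]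
      _ ≤ E (T.erase e) a + (τ * ρ) * (1 / (ρ * δ)) := by
          have := h.edgeProb_le e he
          gcongr
      _ = _ := by field_simp
  have real_bound : ∀ a, J.realization.expect (fun T => (d.iid t).expect fun D =>
      rawValue J (freeProb R A) m D T a e *
        excess (sampleMean (sampleLoad J (freeProb R A) m T a v) D)) ≤
      edgeProb d m e / δ * (1 / (ρ * δ) / t + τ / δ + J.realization.expect fun T => E T a) := by
    intro a
    have h1 := J.expect_mem_mul_le he (F := fun T => 1 / (ρ * δ) / t + E T a) (c := τ / δ)
      (fun T => by have := E_le T a; linarith) (fun T => by have := E_mono T a; linarith)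
    have hX : 0 ≤ 1 / (ρ * δ) / t + τ / δ + J.realization.expect fun T => E T a := by
      have h2 : 0 ≤ J.realization.expect fun T => E T a := PMF.expect_nonneg _ fun T => hE0 T a
      have h3 := h.τ_nonneg
      positivity
    rw [PMF.expect_add, PMF.expect_const] at h1
    set i := indicatorProp (∀ u ∈ e, u ∈ a) with hi
    have hi0 : 0 ≤ i := indicatorProp_nonneg
    calc _ ≤ J.realization.expect (fun T => edgeProb d m e * i / (J.p e * freeProb R A e) *
          (indicatorProp (e ∈ T) * (1 / (ρ * δ) / t + E T a))) := by
          refine PMF.expect_mono _ fun T => (iid_bound T a).trans (le_of_eq ?_)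
          rw [edgeFactor]
          ring
      _ ≤ edgeProb d m e * i / (J.p e * freeProb R A e) *
          (J.p e * (τ / δ + (1 / (ρ * δ) / t + J.realization.expect fun T => E T a))) := by
          rw [PMF.expect_const_mul]
          exact mul_le_mul_of_nonneg_left h1 (by positivity)
      _ = edgeProb d m e * (i / freeProb R A e) *
          (1 / (ρ * δ) / t + τ / δ + J.realization.expect fun T => E T a) := by
          field_simp
          ring
      _ ≤ edgeProb d m e * (1 / δ) *
          (1 / (ρ * δ) / t + τ / δ + J.realization.expect fun T => E T a) := by
          have : i / freeProb R A e ≤ 1 / δ :=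
            div_le_div₀ zero_le_one indicatorProp_le_one hδ (h.le_freeProb e he)
          gcongr
      _ = _ := by ring
  calc _ ≤ R.expect (fun ω => edgeProb d m e / δ * (1 / (ρ * δ) / t + τ / δ +
        J.realization.expect fun T => E T (A ω))) := R.expect_mono fun ω => real_bound (A ω)
    _ = _ := by rw [PMF.expect_const_mul, PMF.expect_add, PMF.expect_const]

/-- In expectation, the value given to `e` is almost the probability of `e`. -/
theorem le_expect_edgeValue {θ η : ℝ} (hθ : 0 < θ) (hη : 0 < η) {e : Sym2 V} (he : e ∈ J.edges) :
    edgeProb d m e * (1 - (2 / δ * (1 / (ρ * δ) / t + τ / δ +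
      ((θ + 6 * τ / δ ^ 2 / θ) / δ + (3 * θ + (1 / (ρ * δ) / δ / t + 7 * τ / δ ^ 2) / θ))) +
        (1 / (ρ * δ) / t + τ / δ) / η)) ≤
      R.expect (fun ω => J.realization.expect fun T => (d.iid t).expect fun D =>
        edgeValue J (freeProb R A) m η D T (A ω) e) := by
  have hδ := h.δ_pos
  have hq := edgeProb_nonneg d m e
  set Γ := (θ + 6 * τ / δ ^ 2 / θ) / δ + (3 * θ + (1 / (ρ * δ) / δ / t + 7 * τ / δ ^ 2) / θ)
    with hΓ
  have pointwise : ∀ (D : Fin t → Ω) T a, rawValue J (freeProb R A) m D T a e -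
      (∑ v with v ∈ e, rawValue J (freeProb R A) m D T a e *
        excess (sampleMean (sampleLoad J (freeProb R A) m T a v) D)) -
      rawValue J (freeProb R A) m D T a e ^ 2 / η ≤
      edgeValue J (freeProb R A) m η D T a e := by
    intro D T a
    rw [edgeValue, ← Finset.mul_sum]
    have hr := h.rawValue_nonneg D T a he
    -- For a lower bound the truncation at 0 can be dropped, which leaves a polynomial in the raw
    -- value and the excesses.
    refine le_trans (le_of_eq ?_) (mul_le_mul_of_nonneg_left (le_max_right _ _) hr)
    ring
  have hmono := R.expect_mono fun ω => J.realization.expect_mono fun T =>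
    (d.iid t).expect_mono fun D => pointwise D T (A ω)
  refine le_trans ?_ hmono
  simp only [PMF.expect_sub, PMF.expect_div_const, PMF.expect_sum]
  rw [h.expect_rawValue ht he]
  have h1 := div_le_div_of_nonneg_right (h.expect_rawValue_sq_le ht he) hη.le
  have h2 : ∑ v with v ∈ e, R.expect (fun ω => J.realization.expect fun T =>
      (d.iid t).expect fun D => rawValue J (freeProb R A) m D T (A ω) e *
        excess (sampleMean (sampleLoad J (freeProb R A) m T (A ω) v) D)) ≤
      2 * (edgeProb d m e / δ * (1 / (ρ * δ) / t + τ / δ + Γ)) := by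
    have hcard : (Finset.univ.filter fun v => v ∈ e).card = 2 := by
      have : (Finset.univ.filter fun v => v ∈ e) = e.toFinset := by
        ext v; simp
      rw [this, Sym2.card_toFinset_of_not_isDiag _ (J.not_isDiag_of_mem_edges he)]
    have h3 := Finset.sum_le_card_nsmul (Finset.univ.filter fun v => v ∈ e) _ _ fun v hv =>
      (h.expect_rawValue_mul_excess_le ht he (Finset.mem_filter.1 hv).2).trans
        (mul_le_mul_of_nonneg_left (add_le_add le_rfl (h.expect_excess_le ht hθ v))
          (div_nonneg hq hδ.le))
    rw [hcard, nsmul_eq_mul] at h3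
    exact_mod_cast h3
  have h4 : edgeProb d m e * (1 - (2 / δ * (1 / (ρ * δ) / t + τ / δ + Γ) +
      (1 / (ρ * δ) / t + τ / δ) / η)) = edgeProb d m e -
      2 * (edgeProb d m e / δ * (1 / (ρ * δ) / t + τ / δ + Γ)) -
      edgeProb d m e * (1 / (ρ * δ) / t + τ / δ) / η := by ring
  rw [h4]
  linarith

end

end IsSparseSampling

end Sampling

/-! ### Crucial edges and the run of the variance-bounding algorithm -/

namespace StochGraph

variable {V : Type u} [Fintype V] [DecidableEq V]

/-- The edges that are often in the matching `μ` of a realization. -/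
noncomputable def crucial (I : StochGraph V) (μ : Finset (Sym2 V) → Finset (Sym2 V)) (τ : ℝ) :
    Finset (Sym2 V) :=
  I.edges.filter fun e => τ * I.pmin ≤ edgeProb I.realization μ e

theorem crucial_subset (I : StochGraph V) (μ : Finset (Sym2 V) → Finset (Sym2 V)) (τ : ℝ) :
    I.crucial μ τ ⊆ I.edges :=
  Finset.filter_subset _ _

theorem edges_crucial (I : StochGraph V) (μ : Finset (Sym2 V) → Finset (Sym2 V)) (τ : ℝ) :
    (I.restrict (I.crucial μ τ)).edges = I.crucial μ τ :=
  I.edges_restrict (I.crucial_subset μ τ)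

theorem edges_noncrucial (I : StochGraph V) (μ : Finset (Sym2 V) → Finset (Sym2 V)) (τ : ℝ) :
    (I.restrict (I.edges \ I.crucial μ τ)).edges = I.edges \ I.crucial μ τ :=
  I.edges_restrict Finset.sdiff_subset

/-- The part in `C` of the matching `μ`, when the edges outside `C` are realized afresh. -/
noncomputable def resampleRule (I : StochGraph V) {μ : Finset (Sym2 V) → Finset (Sym2 V)}
    (hμ : I.IsMaxMatchingRule μ) {C : Finset (Sym2 V)} (hC : C ⊆ I.edges) :
    (I.restrict C).MatchingRule where
  law S := (I.restrict (I.edges \ C)).realization.map fun T => μ (S ∪ T) ∩ C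
  isMatching := by
    intro S hS M hM
    rw [I.edges_restrict hC] at hS
    rw [PMF.mem_support_map_iff] at hM
    obtain ⟨T, hT, rfl⟩ := hM
    have hT' := subset_of_mem_support _ hT
    rw [I.edges_restrict Finset.sdiff_subset] at hT'
    have hm := (hμ (S ∪ T) (Finset.union_subset (hS.trans hC)
      (hT'.trans Finset.sdiff_subset))).1
    refine ⟨fun e he => ?_, (hm.mono Finset.inter_subset_left).2⟩
    rw [Finset.mem_inter] at he
    rcases Finset.mem_union.1 (hm.1 he.1) with h | h
    · exact h
    · exact absurd he.2 (Finset.mem_sdiff.1 (hT' h)).2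

theorem run_expect (I : StochGraph V) {μ : Finset (Sym2 V) → Finset (Sym2 V)}
    (hμ : I.IsMaxMatchingRule μ) {C : Finset (Sym2 V)} (hC : C ⊆ I.edges)
    (alg : MatchingAlgorithm.{u}) (F : Finset (Sym2 V) → Finset (Sym2 V) → ℝ) :
    (alg.run (I.restrict C) (I.resampleRule hμ hC)).expect (fun ω => F ω.1 ω.2.1) =
      (I.restrict C).realization.expect fun S =>
        (I.restrict (I.edges \ C)).realization.expect fun T => F S (μ (S ∪ T) ∩ C) := by
  unfold MatchingAlgorithm.run
  rw [PMF.expect_bind]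
  congr 1
  funext S
  rw [PMF.expect_bind]
  simp only [PMF.expect_map, PMF.expect_const]
  simp only [resampleRule, PMF.expect_map]

theorem run_expect_realized (I : StochGraph V) {μ : Finset (Sym2 V) → Finset (Sym2 V)}
    (hμ : I.IsMaxMatchingRule μ) {C : Finset (Sym2 V)} (hC : C ⊆ I.edges)
    (alg : MatchingAlgorithm.{u}) (F : Finset (Sym2 V) → ℝ) :
    (alg.run (I.restrict C) (I.resampleRule hμ hC)).expect (fun ω => F ω.1) =
      (I.restrict C).realization.expect F := by
  rw [I.run_expect hμ hC alg fun S _ => F S]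
  simp only [PMF.expect_const]

/-- Resampling outside `C` makes M_O distributed as the part in `C` of the optimal matching of a
full realization. -/
theorem run_expect_matching (I : StochGraph V) {μ : Finset (Sym2 V) → Finset (Sym2 V)}
    (hμ : I.IsMaxMatchingRule μ) {C : Finset (Sym2 V)} (hC : C ⊆ I.edges)
    (alg : MatchingAlgorithm.{u}) (F : Finset (Sym2 V) → ℝ) :
    (alg.run (I.restrict C) (I.resampleRule hμ hC)).expect (fun ω => F ω.2.1) =
      I.realization.expect fun S => F (μ S ∩ C) := by
  rw [I.run_expect hμ hC alg fun _ M => F M, I.expect_eq_expect_union hC]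

theorem sum_adj_eq_sum_edges (s : Finset (Sym2 V)) (G : SimpleGraph V) (v : V)
    (hs : ∀ e ∈ s, e ∈ G.edgeSet) (f : Sym2 V → ℝ) (hf : ∀ e, e ∉ s → f e = 0)
    [DecidablePred fun u => G.Adj u v] :
    ∑ u with G.Adj u v, f s(u, v) = ∑ e ∈ s with v ∈ e, f e := by
  have h1 : ∑ u with s(u, v) ∈ s, f s(u, v) = ∑ u with G.Adj u v, f s(u, v) := by
    refine Finset.sum_subset (fun u hu => ?_) fun u _ hu => ?_
    · simp only [Finset.mem_filter, Finset.mem_univ, true_and] at hu ⊢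
      exact hs _ hu
    · simp only [Finset.mem_filter, Finset.mem_univ, true_and] at hu
      exact hf _ hu
  rw [← h1]
  refine Finset.sum_nbij (fun u => s(u, v)) ?_ ?_ ?_ fun _ _ => rfl
  · intro u hu
    simp only [Finset.mem_filter, Finset.mem_univ, true_and] at hu ⊢
    exact ⟨hu, Sym2.mem_mk_right u v⟩
  · intro a _ b _ hab
    exact Sym2.congr_left.1 hab
  · intro e he
    simp only [Finset.coe_filter, Set.mem_ofPred_eq] at he
    obtain ⟨u, hu⟩ := he.2
    refine ⟨u, ?_, ?_⟩
    · simp only [Finset.coe_filter, Finset.mem_univ, true_and, Set.mem_ofPred_eq]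
      rw [Sym2.eq_swap, ← hu]
      exact he.1
    · rw [hu]
      exact Sym2.eq_swap

/-- A matching edge outside `C` at `v` is unique and excludes one inside `C`. In expectation this
links the noncrucial degree of `v` to Pr[v is not matched by M_O]. -/
theorem sum_indicator_le (I : StochGraph V) {M : Finset (Sym2 V)}
    (hM : IsMatchingIn Finset.univ M) (C : Finset (Sym2 V)) (v : V) :
    ∑ e ∈ I.edges \ C with v ∈ e, indicatorProp (e ∈ M) ≤
      indicatorProp (¬ IsMatchedBy (M ∩ C) v) := by
  by_cases hex : ∃ e ∈ I.edges \ C, v ∈ e ∧ e ∈ M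
  · obtain ⟨e, he, hv, heM⟩ := hex
    rw [Finset.sum_eq_single e]
    · rw [indicatorProp_true heM, indicatorProp_true]
      rintro ⟨f, hf, hvf⟩
      rw [Finset.mem_inter] at hf
      have := hM.2 e heM f hf.1 v hv hvf
      exact (Finset.mem_sdiff.1 he).2 (this ▸ hf.2)
    · intro f hf hfe
      exact indicatorProp_false fun hfM =>
        hfe (hM.2 f hfM e heM v (Finset.mem_filter.1 hf).2 hv)
    · exact fun hne => absurd (Finset.mem_filter.2 ⟨he, hv⟩) hne
  · push Not at hex
    rw [Finset.sum_eq_zero]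
    · exact indicatorProp_nonneg
    · intro e he
      rw [Finset.mem_filter] at he
      exact indicatorProp_false (hex e he.1 he.2)

section Reduction

variable (I : StochGraph V) {μ : Finset (Sym2 V) → Finset (Sym2 V)} (hμ : I.IsMaxMatchingRule μ)
  (hμ' : ∀ S, IsMatchingIn Finset.univ (μ S)) {alg : MatchingAlgorithm.{u}} {α δ : ℝ}
  (hδ : 0 < δ) (halg : alg.IsVarianceBounding α δ) {τ : ℝ} (hτ : 0 < τ) (hτ1 : τ < 1)

-- Noncrucial edges are edges of the complement of H, where q is a fractional matching with entries
-- at most τ. So the guarantees on pairs and on the variance of Z_v apply to them.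
include hδ halg hτ hτ1 hμ' in
theorem isSparseSampling (hpos : 0 < I.pmin) (hle : I.pmin ≤ 1) :
    IsSparseSampling I.realization μ (I.restrict (I.edges \ I.crucial μ τ))
      (alg.run (I.restrict (I.crucial μ τ)) (I.resampleRule hμ (I.crucial_subset μ τ)))
      (fun ω => ω.2.2.2) δ τ I.pmin := by
  have hnc := I.edges_noncrucial μ τ
  have hcr := I.edges_crucial μ τ
  set C := I.crucial μ τ with hC
  set σ := I.resampleRule hμ (I.crucial_subset μ τ) with hσ
  set R := alg.run (I.restrict C) σ with hR
  set q := edgeProb I.realization μ with hq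
  have hq0 : ∀ e, 0 ≤ q e := edgeProb_nonneg _ _
  have hqle : ∀ e ∈ I.edges \ C, q e ≤ τ * I.pmin := by
    intro e he
    rw [Finset.mem_sdiff, hC, crucial, Finset.mem_filter, not_and, not_le] at he
    exact (he.2 he.1).le
  have hdeg : ∀ v, ∑ e ∈ I.edges \ C with v ∈ e, q e ≤ R.prob fun ω => v ∈ ω.2.2.2 := by
    intro v
    refine le_trans ?_ (halg.alive V (I.restrict C) σ v)
    rw [PMF.prob_eq_expect, I.run_expect_matching hμ (I.crucial_subset μ τ) alg
      fun M => indicatorProp (¬ IsMatchedBy M v)]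
    simp only [hq, edgeProb]
    rw [← PMF.expect_sum]
    exact PMF.expect_mono _ fun S => I.sum_indicator_le (hμ' S) C v
  have hadj : ∀ e ∈ I.edges \ C, e ∈ (I.restrict C).Gᶜ.edgeSet := by
    intro e he
    rw [Finset.mem_sdiff] at he
    have hd := I.not_isDiag_of_mem_edges he.1
    induction e with | _ x y =>
    rw [SimpleGraph.mem_edgeSet, SimpleGraph.compl_adj]
    refine ⟨by simpa using hd, fun hxy => he.2 ?_⟩
    rw [← hcr, mem_edges]
    exact hxy
  have hfree : ∀ x y, freeProb R (fun ω => ω.2.2.2) s(x, y) =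
      alg.probBoth (I.restrict C) σ x y := by
    intro x y
    unfold freeProb MatchingAlgorithm.probBoth
    rw [PMF.prob_eq_expect]
    simp only [Sym2.ball]
    rfl
  -- The complement of H also contains the nonedges of the base graph; extending by zero keeps them
  -- out of Z_v.
  set x : Sym2 V → ℝ := fun e => if e ∈ I.edges \ C then q e else 0 with hx
  have hx0 : ∀ e, e ∉ I.edges \ C → x e = 0 := fun e he => if_neg he
  have hx1 : ∀ e, x e ≤ τ := by
    intro e
    simp only [hx]
    split_ifs with he
    · exact (hqle e he).trans (mul_le_of_le_one_right hτ.le hle)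
    · exact hτ.le
  have hfrac : IsFractionalMatching (I.restrict C).Gᶜ x := by
    classical
    refine ⟨fun e _ => ⟨?_, (hx1 e).trans hτ1.le⟩, fun v => ?_⟩
    · simp only [hx]
      split_ifs
      · exact hq0 e
      · exact le_rfl
    · refine le_trans (le_of_eq ((Finset.sum_congr (by congr) fun _ _ => rfl).trans
        (sum_adj_eq_sum_edges (I.edges \ C) _ v hadj x hx0))) ?_
      refine le_trans (le_of_eq ?_) ((hdeg v).trans (R.prob_le_one _))
      exact Finset.sum_congr rfl fun e he => if_pos (Finset.mem_filter.1 he).1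
  have hZ : ∀ v a, alg.Z (I.restrict C) σ x v a =
      expectedLoad (I.restrict (I.edges \ C)) (freeProb R fun ω => ω.2.2.2) q a v := by
    intro v a
    classical
    unfold MatchingAlgorithm.Z expectedLoad
    rw [hnc]
    have h1 : ∀ e ∈ (I.edges \ C).filter (fun e => v ∈ e),
        q e / freeProb R (fun ω => ω.2.2.2) e * indicatorProp (∀ u ∈ e, u ≠ v → u ∈ a) =
        x e / freeProb R (fun ω => ω.2.2.2) e * indicatorProp (∀ u ∈ e, u ≠ v → u ∈ a) := by
      intro e he
      simp only [hx, if_pos (Finset.mem_filter.1 he).1]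
    rw [Finset.sum_congr rfl h1, ← sum_adj_eq_sum_edges (I.edges \ C) _ v hadj
      (fun e => x e / freeProb R (fun ω => ω.2.2.2) e *
        indicatorProp (∀ u ∈ e, u ≠ v → u ∈ a)) fun e he => by simp only [hx0 e he]; ring]
    refine Finset.sum_congr (by congr) fun u hu => ?_
    simp only [Finset.mem_filter, Finset.mem_univ, true_and] at hu
    have huv : u ≠ v := hu.ne
    rw [hfree]
    congr 1
    have : (∀ w ∈ s(u, v), w ≠ v → w ∈ a) ↔ u ∈ a := by
      rw [Sym2.ball]
      simp [huv]
    simp only [this]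
    unfold indicatorProp
    congr
  refine ⟨hμ', hδ, hτ.le, hpos, ?_, ?_, ?_, ?_, ?_⟩
  · intro e he
    rw [hnc] at he
    exact I.pmin_le (Finset.mem_sdiff.1 he).1
  · intro e he
    rw [hnc] at he
    have h1 := hadj e he
    induction e with | _ y z =>
    rw [SimpleGraph.mem_edgeSet, SimpleGraph.compl_adj] at h1
    rw [hfree]
    exact halg.both_alive V (I.restrict C) σ y z h1.1 h1.2
  · rw [hnc]
    exact hqle
  · rw [hnc]
    exact hdeg
  · intro v
    have hvar := halg.variance_le V (I.restrict C) σ τ hτ hτ1 x hfrac (fun e _ => hx1 e) v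
    simp only [hZ] at hvar
    exact hvar

end Reduction

end StochGraph

/-! ### Lower bounds for the queried matching -/

/-- The union of the matchings of the samples `D`. -/
def sampledEdges {V Ω : Type*} [DecidableEq V] (m : Ω → Finset (Sym2 V)) {t : ℕ}
    (D : Fin t → Ω) : Finset (Sym2 V) :=
  Finset.univ.biUnion fun i => m (D i)

theorem mem_sampledEdges {V Ω : Type*} [DecidableEq V] {m : Ω → Finset (Sym2 V)} {t : ℕ}
    {D : Fin t → Ω} {e : Sym2 V} : e ∈ sampledEdges m D ↔ ∃ i, e ∈ m (D i) := by
  simp [sampledEdges]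

/-- The edge is missed with probability (1 − q)^t ≤ (1 + q)^(−t) ≤ 1/(1 + tq), by Bernoulli's
inequality. -/
theorem le_prob_mem_sampledEdges {V Ω : Type*} [DecidableEq V] [Fintype Ω] (d : PMF Ω)
    (m : Ω → Finset (Sym2 V)) {t : ℕ} {e : Sym2 V} {x : ℝ} (hx : 0 < t * x)
    (hxq : x ≤ edgeProb d m e) :
    1 - 1 / (t * x) ≤ (d.iid t).expect fun D => indicatorProp (e ∈ sampledEdges m D) := by
  set q := edgeProb d m e with hq
  have hq0 : 0 ≤ q := edgeProb_nonneg d m e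
  have hq1 : q ≤ 1 := d.prob_le_one _
  have h1 : (d.iid t).expect (fun D => indicatorProp (e ∈ sampledEdges m D)) = 1 - (1 - q) ^ t := by
    have h2 : d.prob (fun ω => ¬ e ∈ m ω) = 1 - q := by
      simp only [PMF.prob_eq_expect, indicatorProp_not]
      rw [PMF.expect_sub, PMF.expect_const, hq, edgeProb]
    rw [← h2, ← PMF.prob_iid_forall, PMF.prob_eq_expect, ← (d.iid t).expect_const 1,
      ← PMF.expect_sub]
    congr 1
    funext D
    rw [← indicatorProp_not]
    congr 1
    rw [mem_sampledEdges]
    push Not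
    rfl
  rw [h1]
  have h3 : (1 - q) ^ t * (1 + q) ^ t ≤ 1 := by
    rw [← mul_pow]
    exact pow_le_one₀ (mul_nonneg (by linarith) (by linarith)) (by nlinarith)
  have h4 : 1 + t * q ≤ (1 + q) ^ t := one_add_mul_le_pow (by linarith) t
  have h5 : (t : ℝ) * x ≤ t * q := mul_le_mul_of_nonneg_left hxq (Nat.cast_nonneg t)
  have h6 : 0 ≤ (1 - q) ^ t := pow_nonneg (by linarith) t
  have h7 : (1 - q) ^ t ≤ 1 / (t * x) := by
    rw [le_div_iff₀ hx]
    nlinarith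
  linarith

namespace StochGraph

variable {V : Type u} [Fintype V] [DecidableEq V]

section Bounds

variable (I : StochGraph V) {μ : Finset (Sym2 V) → Finset (Sym2 V)}

theorem weight_inter {V : Type u} [DecidableEq V] (I : StochGraph V) (M C : Finset (Sym2 V)) :
    I.weight (M ∩ C) = ∑ e ∈ C, indicatorProp (e ∈ M) * I.w e := by
  classical
  unfold weight indicatorProp
  simp only [ite_mul, one_mul, zero_mul]
  rw [← Finset.sum_filter]
  refine Finset.sum_congr ?_ fun _ _ => rfl
  ext e
  simp [and_comm]

theorem expect_weight_inter {V : Type u} [DecidableEq V] (I : StochGraph V) {Ω' : Type*}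
    [Fintype Ω'] (R : PMF Ω') (M : Ω' → Finset (Sym2 V)) (C : Finset (Sym2 V)) :
    R.expect (fun ω => I.weight (M ω ∩ C)) = ∑ e ∈ C, edgeProb R M e * I.w e := by
  simp only [weight_inter, PMF.expect_sum, PMF.expect_mul_const, edgeProb]

/-- Edges that are sampled with probability at least `ζ` retain a `ζ` fraction of the weight of an
independent random edge set. -/
theorem le_expect_weight_inter_sampledEdges {Ω' : Type*} [Fintype Ω'] (R : PMF Ω')
    (M : Ω' → Finset (Sym2 V)) {C : Finset (Sym2 V)} (hC : C ⊆ I.edges) {t : ℕ} {ζ : ℝ}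
    (hζ : ∀ e ∈ C, ζ ≤ (I.realization.iid t).expect fun D =>
      indicatorProp (e ∈ sampledEdges μ D)) :
    ζ * R.expect (fun ω => I.weight (M ω ∩ C)) ≤ (I.realization.iid t).expect fun D =>
      R.expect fun ω => I.weight (M ω ∩ C ∩ sampledEdges μ D) := by
  have hw : ∀ (D : Fin t → Finset (Sym2 V)) ω, I.weight (M ω ∩ C ∩ sampledEdges μ D) =
      ∑ e ∈ C, indicatorProp (e ∈ M ω) * (indicatorProp (e ∈ sampledEdges μ D) * I.w e) := by
    intro D ω
    rw [Finset.inter_right_comm, weight_inter]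
    refine Finset.sum_congr rfl fun e _ => ?_
    rw [← mul_assoc]
    congr 1
    by_cases h1 : e ∈ M ω <;> by_cases h2 : e ∈ sampledEdges μ D <;>
      simp [indicatorProp, h1, h2]
  rw [expect_weight_inter, Finset.mul_sum]
  simp only [hw, PMF.expect_sum, PMF.expect_mul_const, PMF.expect_const_mul]
  refine Finset.sum_le_sum fun e he => ?_
  have h1 := mul_le_mul_of_nonneg_left (hζ e he)
    (mul_nonneg (edgeProb_nonneg R M e) (I.mem_edges_w_nonneg (hC he)))
  refine le_trans (le_of_eq ?_) (h1.trans (le_of_eq ?_))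
  · ring
  · rw [edgeProb]; ring

variable (hμ : I.IsMaxMatchingRule μ) (hμe : ∀ S, μ S ⊆ I.edges)

include hμe in
theorem sampledEdges_subset {t : ℕ} (D : Fin t → Finset (Sym2 V)) :
    sampledEdges μ D ⊆ I.edges := fun _ he =>
  let ⟨_, hi⟩ := mem_sampledEdges.1 he
  hμe _ hi

include hμ in
theorem weight_inter_sampledEdges_le {t : ℕ} (D : Fin t → Finset (Sym2 V))
    (C : Finset (Sym2 V)) {S : Finset (Sym2 V)} (hS : S ⊆ I.edges) :
    I.weight (μ S ∩ C ∩ sampledEdges μ D) ≤ I.weight (μ (sampledEdges μ D ∩ S)) := by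
  have hm := (hμ S hS).1
  refine (hμ _ (Finset.inter_subset_right.trans hS)).2 _ ⟨?_, ?_⟩
  · intro e he
    simp only [Finset.mem_inter] at he ⊢
    exact ⟨he.2, hm.1 he.1.1⟩
  · exact (hm.mono (Finset.inter_subset_left.trans Finset.inter_subset_left)).2

include hμ hμe in
/-- The matching found among the crucial edges can be augmented by a matching of the noncrucial
edges between free vertices. -/
theorem weight_add_sum_edgeValue_le {C : Finset (Sym2 V)} {Ω' : Type*} [Fintype Ω']
    {R : PMF Ω'} {A : Ω' → Finset V} {δ τ ρ : ℝ}
    (h : IsSparseSampling I.realization μ (I.restrict (I.edges \ C)) R A δ τ ρ)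
    {η s : ℝ} (hη : 0 < η) (hs : 0 < s) (hηs : η * (1 + s) < s ^ 2) {t : ℕ}
    (D : Fin t → Finset (Sym2 V)) (T : Finset (Sym2 V)) {S M : Finset (Sym2 V)}
    (hM : IsMatchingIn S M) {a : Finset V} (ha : ∀ v ∈ a, ¬ IsMatchedBy M v) :
    I.weight (M ∩ C ∩ sampledEdges μ D) + 1 / (1 + s) * ∑ e ∈ I.edges \ C,
      edgeValue (I.restrict (I.edges \ C)) (freeProb R A) μ η D T a e * I.w e ≤
      I.weight (μ (sampledEdges μ D ∩ (S ∪ T))) := by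
  classical
  have hnc := I.edges_restrict (C := I.edges \ C) Finset.sdiff_subset
  set J := I.restrict (I.edges \ C)
  set y := edgeValue J (freeProb R A) μ η D T a with hy
  set X := (I.edges \ C).filter fun e => y e ≠ 0 with hX
  have hXsub : X ⊆ I.edges \ C := Finset.filter_subset _ _
  have hXe : X ⊆ I.edges := hXsub.trans Finset.sdiff_subset
  have hy0 : ∀ e ∈ I.edges \ C, 0 ≤ y e := fun e he =>
    h.edgeValue_nonneg η D T a (by rwa [hnc])
  obtain ⟨N, hN, hNw⟩ := exists_matching_of_fractional (S := X)
    (fun e he => I.not_isDiag_of_mem_edges (hXe he)) I.w y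
    (fun e he => I.mem_edges_w_nonneg (hXe he)) (fun e he => hy0 e (hXsub he))
    (fun e he => h.edgeValue_le hη D T a (by rw [hnc]; exact hXsub he)) hη.le hs hηs
    (fun v => by
      have h1 := h.sum_edgeValue_le hη D T a v
      rw [hnc] at h1
      refine le_trans ?_ h1
      refine Finset.sum_le_sum_of_subset_of_nonneg (Finset.filter_subset_filter _ hXsub) ?_
      intro e he _
      exact hy0 e (Finset.mem_filter.1 he).1)
  have hsum : ∑ e ∈ X, y e * I.w e = ∑ e ∈ I.edges \ C, y e * I.w e := by
    refine Finset.sum_subset hXsub fun e he hne => ?_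
    have : y e = 0 := by
      by_contra h0
      exact hne (Finset.mem_filter.2 ⟨he, h0⟩)
    rw [this, zero_mul]
  rw [hsum] at hNw
  have hNprop : ∀ e ∈ N, e ∈ I.edges \ C ∧ e ∈ sampledEdges μ D ∧ e ∈ T ∧ ∀ v ∈ e, v ∈ a := by
    intro e he
    have h1 := Finset.mem_filter.1 (hN.1 he)
    have h2 := of_edgeValue_ne_zero h1.2
    exact ⟨h1.1, mem_sampledEdges.2 h2.1, h2.2.1, h2.2.2⟩
  have hdisj : Disjoint (M ∩ C ∩ sampledEdges μ D) N := by
    rw [Finset.disjoint_left]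
    intro e he heN
    simp only [Finset.mem_inter] at he
    exact (Finset.mem_sdiff.1 (hNprop e heN).1).2 he.1.2
  have hcross : ∀ e ∈ M ∩ C ∩ sampledEdges μ D, ∀ f ∈ N, ∀ v, v ∈ e → v ∈ f → False := by
    intro e he f hf v hve hvf
    simp only [Finset.mem_inter] at he
    exact ha v ((hNprop f hf).2.2.2 v hvf) ⟨e, he.1.1, hve⟩
  have hmatch : IsMatchingIn (sampledEdges μ D ∩ (S ∪ T)) (M ∩ C ∩ sampledEdges μ D ∪ N) := by
    refine ⟨fun e he => ?_, fun e he f hf v hve hvf => ?_⟩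
    · rw [Finset.mem_inter, Finset.mem_union]
      rcases Finset.mem_union.1 he with he | he
      · simp only [Finset.mem_inter] at he
        exact ⟨he.2, Or.inl (hM.1 he.1.1)⟩
      · exact ⟨(hNprop e he).2.1, Or.inr (hNprop e he).2.2.1⟩
    · rcases Finset.mem_union.1 he with he | he <;> rcases Finset.mem_union.1 hf with hf | hf
      · simp only [Finset.mem_inter] at he hf
        exact hM.2 e he.1.1 f hf.1.1 v hve hvf
      · exact (hcross e he f hf v hve hvf).elim
      · exact (hcross f hf e he v hvf hve).elim
      · exact hN.2 e he f hf v hve hvf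
  have hmax := (hμ _ (Finset.inter_subset_left.trans (I.sampledEdges_subset hμe D))).2 _ hmatch
  refine le_trans ?_ hmax
  have hw : I.weight (M ∩ C ∩ sampledEdges μ D ∪ N) =
      I.weight (M ∩ C ∩ sampledEdges μ D) + ∑ e ∈ N, I.w e := Finset.sum_union hdisj
  rw [hw]
  refine add_le_add le_rfl ?_
  rw [one_div, inv_mul_le_iff₀ (by linarith)]
  exact hNw

variable (hμ' : ∀ S, IsMatchingIn Finset.univ (μ S)) {alg : MatchingAlgorithm.{u}} {α δ : ℝ}
  (hδ : 0 < δ) (halg : alg.IsVarianceBounding α δ) {τ : ℝ} (hτ : 0 < τ) (hτ1 : τ < 1)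
  {t : ℕ} {ζ : ℝ} (hζ : ∀ e ∈ I.crucial μ τ, ζ ≤ (I.realization.iid t).expect fun D =>
      indicatorProp (e ∈ sampledEdges μ D))

-- The crucial edges of the optimal matching that were sampled form a matching of the queried
-- realized graph, and the samples are independent of that realization.
include hμ hζ in
theorem le_expect_weight_crucial :
    ζ * ∑ e ∈ I.crucial μ τ, edgeProb I.realization μ e * I.w e ≤
      (I.realization.iid t).expect fun D => I.realization.expect fun S =>
        I.weight (μ (sampledEdges μ D ∩ S)) := by
  rw [← expect_weight_inter]
  refine (I.le_expect_weight_inter_sampledEdges _ μ (I.crucial_subset μ τ) hζ).trans ?_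
  refine PMF.expect_mono _ fun D => PMF.expect_mono_support _ fun S hS => ?_
  exact I.weight_inter_sampledEdges_le hμ D _ (I.subset_of_mem_support hS)

-- The first term is M_c thinned to the sampled edges, the second the rounded edge values. The
-- samples are independent of the run and of the noncrucial realization; the crucial realization of
-- the run and the noncrucial one together have the law of a full realization.
include hμe hμ' hδ halg hτ hτ1 hζ in
theorem le_expect_weight_augmented (hζ0 : 0 ≤ ζ) (hpos : 0 < I.pmin) (hle : I.pmin ≤ 1)
    {η s lam : ℝ} (hη : 0 < η) (hs : 0 < s) (hηs : η * (1 + s) < s ^ 2)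
    (hlam : ∀ e ∈ I.edges \ I.crucial μ τ, edgeProb I.realization μ e * lam ≤
      (alg.run (I.restrict (I.crucial μ τ)) (I.resampleRule hμ (I.crucial_subset μ τ))).expect
        fun ω => (I.restrict (I.edges \ I.crucial μ τ)).realization.expect fun T =>
          (I.realization.iid t).expect fun D => edgeValue (I.restrict (I.edges \ I.crucial μ τ))
            (freeProb (alg.run (I.restrict (I.crucial μ τ))
              (I.resampleRule hμ (I.crucial_subset μ τ))) fun ω => ω.2.2.2) μ η D T ω.2.2.2 e) :
    ζ * (α * ∑ e ∈ I.crucial μ τ, edgeProb I.realization μ e * I.w e) +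
      1 / (1 + s) * (lam * ∑ e ∈ I.edges \ I.crucial μ τ, edgeProb I.realization μ e * I.w e) ≤
      (I.realization.iid t).expect fun D => I.realization.expect fun S =>
        I.weight (μ (sampledEdges μ D ∩ S)) := by
  have h := I.isSparseSampling hμ hμ' hδ halg hτ hτ1 hpos hle
  have hcr := I.edges_crucial μ τ
  have hCsub := I.crucial_subset μ τ
  have hrun := I.run_expect_realized hμ hCsub alg
  have hrunM := I.run_expect_matching hμ hCsub alg
  set C := I.crucial μ τ with hC
  set σ := I.resampleRule hμ (I.crucial_subset μ τ) with hσ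
  set R := alg.run (I.restrict C) σ with hR
  set J := I.restrict (I.edges \ C) with hJ
  set P := freeProb R fun ω => ω.2.2.2 with hP
  have hMcsub : ∀ ω ∈ R.support, ω.2.2.1 ∩ C = ω.2.2.1 := by
    intro ω hω
    refine Finset.inter_eq_left.2 ((halg.isMatching V (I.restrict C) σ ω hω).1.trans ?_)
    -- That the realized set lies in `C` on the support of the run is read off from its marginal
    -- law: a nonnegative function with mean zero vanishes there.
    have h1 : R.expect (fun ω => indicatorProp (¬ ω.1 ⊆ C)) = 0 := by
      rw [hrun fun S => indicatorProp (¬ S ⊆ C), ← (I.restrict C).realization.expect_const 0]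
      refine PMF.expect_congr_support _ fun S hS => indicatorProp_false ?_
      rw [not_not, ← hcr]
      exact subset_of_mem_support _ hS
    by_contra hne
    have h2 := (Finset.sum_eq_zero_iff_of_nonneg fun ω _ =>
      mul_nonneg ENNReal.toReal_nonneg indicatorProp_nonneg).1 h1 ω (Finset.mem_univ ω)
    rw [indicatorProp_true hne, mul_one, ENNReal.toReal_eq_zero_iff] at h2
    exact h2.elim hω (R.apply_ne_top ω)
  have hcruc : ζ * (α * ∑ e ∈ C, edgeProb I.realization μ e * I.w e) ≤
      (I.realization.iid t).expect fun D => R.expect fun ω =>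
        I.weight (ω.2.2.1 ∩ C ∩ sampledEdges μ D) := by
    refine le_trans (mul_le_mul_of_nonneg_left ?_ hζ0)
      (I.le_expect_weight_inter_sampledEdges R (fun ω => ω.2.2.1) hCsub hζ)
    have h1 := halg.approx V (I.restrict C) σ
    rw [← hR, hrunM fun M => (I.restrict C).weight M] at h1
    rw [← expect_weight_inter]
    refine h1.trans (le_of_eq (R.expect_congr_support fun ω hω => ?_))
    rw [hMcsub ω hω]
    rfl
  have hrest : lam * ∑ e ∈ I.edges \ C, edgeProb I.realization μ e * I.w e ≤
      (I.realization.iid t).expect fun D => R.expect fun ω => J.realization.expect fun T =>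
        ∑ e ∈ I.edges \ C, edgeValue J P μ η D T ω.2.2.2 e * I.w e := by
    simp only [PMF.expect_sum, PMF.expect_mul_const]
    rw [Finset.mul_sum]
    refine Finset.sum_le_sum fun e he => ?_
    have h1 := mul_le_mul_of_nonneg_right (hlam e he)
      (I.mem_edges_w_nonneg (Finset.mem_sdiff.1 he).1)
    rw [PMF.expect_comm]
    simp only [PMF.expect_comm (I.realization.iid t) J.realization]
    refine le_trans (le_of_eq ?_) h1
    ring
  calc _ ≤ (I.realization.iid t).expect (fun D => R.expect fun ω =>
          I.weight (ω.2.2.1 ∩ C ∩ sampledEdges μ D)) + 1 / (1 + s) *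
        (I.realization.iid t).expect fun D => R.expect fun ω => J.realization.expect fun T =>
        ∑ e ∈ I.edges \ C, edgeValue J P μ η D T ω.2.2.2 e * I.w e := by
        have : 0 ≤ 1 / (1 + s) := by positivity
        gcongr
    _ = (I.realization.iid t).expect fun D => R.expect fun ω => J.realization.expect fun T =>
        (I.weight (ω.2.2.1 ∩ C ∩ sampledEdges μ D) + 1 / (1 + s) *
        ∑ e ∈ I.edges \ C, edgeValue J P μ η D T ω.2.2.2 e * I.w e) := by
        simp only [PMF.expect_add, PMF.expect_const_mul, PMF.expect_const]
    _ ≤ (I.realization.iid t).expect fun D => R.expect fun ω => J.realization.expect fun T =>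
        I.weight (μ (sampledEdges μ D ∩ (ω.1 ∪ T))) := by
        refine PMF.expect_mono _ fun D => R.expect_mono_support fun ω hω =>
          PMF.expect_mono _ fun T => ?_
        exact I.weight_add_sum_edgeValue_le hμ hμe h hη hs hηs D T
          (halg.isMatching V (I.restrict C) σ ω hω) (halg.unmatched V (I.restrict C) σ ω hω)
    _ = _ := by
        congr 1
        funext D
        rw [I.expect_eq_expect_union hCsub, ← hrun fun S => J.realization.expect fun T =>
          I.weight (μ (sampledEdges μ D ∩ (S ∪ T)))]

end Bounds

end StochGraph

/-! ### Choice of the constants and conclusion -/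

open StochGraph

/-- Here `k` stands for 1/(pδt). The total error is linear, c θ + c1 k + c2 τ, where c1 and c2
involve 1/θ and 1/η. So `s` and `η` are fixed by ε, then `θ` is chosen, and only then `τ` and the
bound `κ` on `k`. -/
theorem exists_parameters {ε δ : ℝ} (hε : 0 < ε) (hε1 : ε < 1) (hδ : 0 < δ) :
    ∃ τ θ η s κ : ℝ, 0 < τ ∧ τ < 1 ∧ 0 < θ ∧ 0 < η ∧ 0 < s ∧ 0 < κ ∧ η * (1 + s) < s ^ 2 ∧
      1 - ε ≤ 1 / (1 + s) * (1 - ε / 2) ∧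
      ∀ k ≤ κ, 2 / δ * (k + τ / δ + ((θ + 6 * τ / δ ^ 2 / θ) / δ +
        (3 * θ + (k / δ + 7 * τ / δ ^ 2) / θ))) + (k + τ / δ) / η ≤ ε / 2 := by
  set s := ε / 2 with hs
  have hs0 : 0 < s := by positivity
  set η := s ^ 2 / 4 with hη
  have hη0 : 0 < η := by positivity
  set c := 2 / δ * (1 / δ + 3) with hc
  have hc0 : 0 < c := by positivity
  set θ := ε / (4 * c) with hθ
  have hθ0 : 0 < θ := by positivity
  set c1 := 2 / δ * (1 + 1 / (δ * θ)) + 1 / η with hc1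
  have hc10 : 0 < c1 := by positivity
  set c2 := 2 / δ * (1 / δ + 6 / (δ ^ 2 * θ * δ) + 7 / (δ ^ 2 * θ)) + 1 / (δ * η) with hc2
  have hc20 : 0 < c2 := by positivity
  refine ⟨min (1 / 2) (ε / (8 * c2)), θ, η, s, ε / (8 * c1), by positivity, ?_, hθ0, hη0, hs0,
    by positivity, ?_, ?_, ?_⟩
  · exact (min_le_left _ _).trans_lt (by norm_num)
  · rw [hη]
    have : s < 1 := by linarith
    have h2 : 0 < s ^ 2 := by positivity
    nlinarith
  · rw [one_div, ← div_eq_inv_mul, le_div_iff₀ (by linarith), hs]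
    nlinarith
  · intro k hk
    set τ := min (1 / 2) (ε / (8 * c2))
    have hτ : τ ≤ ε / (8 * c2) := min_le_right _ _
    have h1 : c1 * k ≤ ε / 8 := by
      calc c1 * k ≤ c1 * (ε / (8 * c1)) := mul_le_mul_of_nonneg_left hk hc10.le
        _ = ε / 8 := by field_simp
    have h2 : c2 * τ ≤ ε / 8 := by
      calc c2 * τ ≤ c2 * (ε / (8 * c2)) := mul_le_mul_of_nonneg_left hτ hc20.le
        _ = ε / 8 := by field_simp
    have h3 : c * θ = ε / 4 := by rw [hθ]; field_simp
    have h4 : 2 / δ * (k + τ / δ + ((θ + 6 * τ / δ ^ 2 / θ) / δ +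
        (3 * θ + (k / δ + 7 * τ / δ ^ 2) / θ))) + (k + τ / δ) / η = c * θ + c1 * k + c2 * τ := by
      rw [hc, hc1, hc2]
      field_simp
      ring
    rw [h4]
    linarith

namespace StochGraph

variable {V : Type u} [Fintype V] [DecidableEq V] (I : StochGraph V)
  {μ : Finset (Sym2 V) → Finset (Sym2 V)}

theorem expectedOpt_eq_sum (hμe : ∀ S, μ S ⊆ I.edges) :
    I.expectedOpt μ = ∑ e ∈ I.edges, edgeProb I.realization μ e * I.w e := by
  rw [← expect_weight_inter, expectedOpt]
  simp only [Finset.inter_eq_left.2 (hμe _)]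

theorem expectedValue_selectQueries (t : ℕ) :
    I.expectedValue μ (I.selectQueries μ t) = (I.realization.iid t).expect fun D =>
      I.realization.expect fun S => I.weight (μ (sampledEdges μ D ∩ S)) :=
  I.selectQueries_expect μ t _

/-- A rule is constrained only on subgraphs of the base graph. Precomposing with the intersection
makes it a matching of the base graph everywhere and changes nothing on realizations. -/
theorem isMaxMatchingRule_inter_edges (hμ : I.IsMaxMatchingRule μ) :
    I.IsMaxMatchingRule fun S => μ (S ∩ I.edges) := by
  intro S hS
  simp only [Finset.inter_eq_left.2 hS]
  exact hμ S hS

theorem expectedOpt_inter_edges :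
    I.expectedOpt (fun S => μ (S ∩ I.edges)) = I.expectedOpt μ :=
  PMF.expect_congr_support _ fun S hS => by
    simp only [Finset.inter_eq_left.2 (I.subset_of_mem_support hS)]

theorem expectedValue_inter_edges (t : ℕ) :
    I.expectedValue (fun S => μ (S ∩ I.edges)) (I.selectQueries (fun S => μ (S ∩ I.edges)) t) =
      I.expectedValue μ (I.selectQueries μ t) := by
  rw [expectedValue_selectQueries, expectedValue_selectQueries]
  refine PMF.expect_congr_support _ fun D hD => PMF.expect_congr_support _ fun S hS => ?_
  have h1 : sampledEdges (fun S => μ (S ∩ I.edges)) D = sampledEdges μ D := by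
    ext e
    simp only [mem_sampledEdges, Finset.inter_eq_left.2
      (I.subset_of_mem_support (PMF.mem_support_of_mem_support_iid hD _))]
  rw [h1, Finset.inter_eq_left.2
    (Finset.inter_subset_right.trans (I.subset_of_mem_support hS))]

theorem expectedValue_nonneg (hμ : I.IsMaxMatchingRule μ) (d : PMF (Finset (Sym2 V))) :
    0 ≤ I.expectedValue μ d := by
  refine PMF.expect_nonneg _ fun Q => ?_
  rw [← I.realization.expect_const 0]
  refine PMF.expect_mono_support _ fun S hS => Finset.sum_nonneg fun e he => ?_
  have hsub : Q ∩ S ⊆ I.edges := Finset.inter_subset_right.trans (I.subset_of_mem_support hS)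
  exact I.mem_edges_w_nonneg (hsub ((hμ _ hsub).1.1 he))

end StochGraph

theorem lemma4p2 (α ε : ℝ) (hα : 1 / 2 < α) (hα' : α < 1) (hε : 0 < ε) (hε' : ε < 1 / 10)
    (hVB : ∃ (δ : ℝ) (alg : MatchingAlgorithm.{u}),
      0 < δ ∧ δ < 1 ∧ alg.IsVarianceBounding α δ) :
    ∃ K : ℝ, 0 < K ∧
      ∀ (V : Type u) [Fintype V] [DecidableEq V] (I : StochGraph V)
        (μ : Finset (Sym2 V) → Finset (Sym2 V)), I.IsMaxMatchingRule μ →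
        (∀ Q ∈ (I.selectQueries μ ⌊K / I.pmin⌋₊).support,
          Q ⊆ I.edges ∧ ∀ v, (edgeDegree Q v : ℝ) ≤ K / I.pmin) ∧
        (1 / (2 - α) - ε) * I.expectedOpt μ ≤
          I.expectedValue μ (I.selectQueries μ ⌊K / I.pmin⌋₊) := by
  obtain ⟨δ, alg, hδ, -, halg⟩ := hVB
  obtain ⟨τ, θ, η, s, κ, hτ, hτ1, hθ, hη, hs, hκ, hηs, hεs, hΛ⟩ :=
    exists_parameters hε (by linarith) hδ
  -- The 1 pays for the floor, as p ≤ 1. The second term gives 1/(pδt) ≤ κ, and the third makes a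
  -- crucial edge sampled with probability at least 1 − ε.
  refine ⟨1 + 1 / (κ * δ) + 1 / (τ * ε), by positivity, ?_⟩
  set K := 1 + 1 / (κ * δ) + 1 / (τ * ε) with hK
  have hK0 : 0 < K := by positivity
  intro V _ _ I μ₀ hμ₀
  have hp0 : 0 ≤ I.pmin := Real.iInf_nonneg fun e => (I.p_pos e e.2).le
  -- Without edges `I.pmin` is an infimum over the empty type, hence 0; division by zero then gives
  -- `t = 0` and an empty query set.
  set t := ⌊K / I.pmin⌋₊ with ht
  refine ⟨fun Q hQ => ?_, ?_⟩
  · have h1 := I.selectQueries_support hμ₀ t Q hQ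
    refine ⟨h1.1, fun v => ?_⟩
    calc (edgeDegree Q v : ℝ) ≤ t := by exact_mod_cast h1.2 v
      _ ≤ K / I.pmin := Nat.floor_le (div_nonneg hK0.le hp0)
  rw [← I.expectedOpt_inter_edges, ← I.expectedValue_inter_edges]
  have hμ := I.isMaxMatchingRule_inter_edges hμ₀
  have hμ' : ∀ S, IsMatchingIn Finset.univ (μ₀ (S ∩ I.edges)) := fun S =>
    ⟨Finset.subset_univ _, (hμ₀ _ Finset.inter_subset_right).1.2⟩
  have hμe : ∀ S, μ₀ (S ∩ I.edges) ⊆ I.edges := fun S =>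
    (hμ₀ _ Finset.inter_subset_right).1.1.trans Finset.inter_subset_right
  set μ : Finset (Sym2 V) → Finset (Sym2 V) := fun S => μ₀ (S ∩ I.edges)
  rcases I.edges.eq_empty_or_nonempty with hE | ⟨e₀, he₀⟩
  · rw [I.expectedOpt_eq_sum hμe, hE, Finset.sum_empty, mul_zero]
    exact I.expectedValue_nonneg hμ _
  have hpos : 0 < I.pmin := I.pmin_pos he₀
  have hle : I.pmin ≤ 1 := (I.pmin_le he₀).trans (I.mem_edges_p_le_one he₀)
  have htp : 1 / (κ * δ) + 1 / (τ * ε) ≤ t * I.pmin := by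
    have h1 := Nat.lt_floor_add_one (K / I.pmin)
    rw [div_lt_iff₀ hpos, ← ht] at h1
    linarith
  have htp1 : 1 / (κ * δ) ≤ t * I.pmin := by
    have : 0 < 1 / (τ * ε) := by positivity
    linarith
  have htp2 : 1 / (τ * ε) ≤ t * I.pmin := by
    have : 0 < 1 / (κ * δ) := by positivity
    linarith
  have htp0 : 0 < t * I.pmin := lt_of_lt_of_le (by positivity) htp1
  have ht0 : t ≠ 0 := by
    intro h0
    rw [h0, Nat.cast_zero, zero_mul] at htp0
    exact lt_irrefl _ htp0
  have hk : 1 / (I.pmin * δ) / t ≤ κ := by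
    have hT : (0 : ℝ) < t := by positivity
    rw [div_le_iff₀ (by positivity)] at htp1
    rw [div_div, div_le_iff₀ (by positivity)]
    linarith
  have hζ : ∀ e ∈ I.crucial μ τ, 1 - ε ≤ (I.realization.iid t).expect fun D =>
      indicatorProp (e ∈ sampledEdges μ D) := by
    intro e he
    have h1 : 0 < t * (τ * I.pmin) := by
      rw [mul_left_comm]; positivity
    refine le_trans ?_ (le_prob_mem_sampledEdges I.realization μ h1 (Finset.mem_filter.1 he).2)
    have h2 : 1 / (t * (τ * I.pmin)) ≤ ε := by
      rw [div_le_iff₀ (by positivity)] at htp2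
      rw [div_le_iff₀ h1]
      linarith
    linarith
  have hsparse := I.isSparseSampling hμ hμ' hδ halg hτ hτ1 hpos hle
  have hlow := I.le_expect_weight_crucial hμ hζ
  have haug := I.le_expect_weight_augmented hμ hμe hμ' hδ halg hτ hτ1 hζ (by linarith) hpos hle
    (lam := 1 - ε / 2) hη hs hηs fun e he => by
      refine le_trans (mul_le_mul_of_nonneg_left ?_ (edgeProb_nonneg _ _ _))
        (hsparse.le_expect_edgeValue ht0 hθ hη (by rw [I.edges_noncrucial]; exact he))
      have h1 := hΛ _ hk
      have h2 : 1 / (I.pmin * δ) / δ / t = 1 / (I.pmin * δ) / t / δ := by ring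
      rw [h2]
      linarith
  have hC0 : 0 ≤ ∑ e ∈ I.crucial μ τ, edgeProb I.realization μ e * I.w e :=
    Finset.sum_nonneg fun e he => mul_nonneg (edgeProb_nonneg _ _ _)
      (I.mem_edges_w_nonneg (I.crucial_subset μ τ he))
  have hN0 : 0 ≤ ∑ e ∈ I.edges \ I.crucial μ τ, edgeProb I.realization μ e * I.w e :=
    Finset.sum_nonneg fun e he => mul_nonneg (edgeProb_nonneg _ _ _)
      (I.mem_edges_w_nonneg (Finset.mem_sdiff.1 he).1)
  have hopt : I.expectedOpt μ =
      ∑ e ∈ I.edges \ I.crucial μ τ, edgeProb I.realization μ e * I.w e +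
        ∑ e ∈ I.crucial μ τ, edgeProb I.realization μ e * I.w e := by
    rw [I.expectedOpt_eq_sum hμe, Finset.sum_sdiff (I.crucial_subset μ τ)]
  rw [expectedValue_selectQueries, hopt]
  set W := (I.realization.iid t).expect fun D => I.realization.expect fun S =>
    I.weight (μ (sampledEdges μ D ∩ S))
  set C := ∑ e ∈ I.crucial μ τ, edgeProb I.realization μ e * I.w e
  set N := ∑ e ∈ I.edges \ I.crucial μ τ, edgeProb I.realization μ e * I.w e
  have h1 : (1 - ε) * N ≤ 1 / (1 + s) * ((1 - ε / 2) * N) := by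
    rw [← mul_assoc]
    exact mul_le_mul_of_nonneg_right hεs hN0
  -- The weight 1 − α on the crucial bound makes up exactly for the αC in the augmented one.
  have h2 : (1 - ε) * (N + C) ≤ (2 - α) * W := by
    have h3 := mul_le_mul_of_nonneg_left hlow (by linarith : 0 ≤ 1 - α)
    linarith
  calc (1 / (2 - α) - ε) * (N + C) ≤ ((1 - ε) / (2 - α)) * (N + C) := by
        refine mul_le_mul_of_nonneg_right ?_ (add_nonneg hN0 hC0)
        rw [sub_div]
        have : ε / (2 - α) ≤ ε := div_le_self hε.le (by linarith)
        linarith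
    _ = (1 - ε) * (N + C) / (2 - α) := by ring
    _ ≤ W := by
        rw [div_le_iff₀ (by linarith)]
        linarith
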